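/- Let $n\in\mathbb N$, $m\in\mathbb R$, $\rho>0$, $\delta\ge 0$, and let $\sigma\in S^m_{\rho,\delta}$, i.e. $\sigma\in C^\infty(\mathbb R^n\times\mathbb R^n)$ is complex-valued and for all $\alpha,\beta\in\mathbb N^n$ there is $C_{\alpha,\beta}$ with $|\partial_x^\alpha\partial_\xi^\beta\sigma(x,\xi)|\le C_{\alpha,\beta}(1+|\xi|)^{m-\rho|\beta|+\delta|\alpha|}$ for all $x,\xi\in\mathbb R^n$. Let $k(x,z)=(2\pi)^{-n}\int_{\mathbb R^n}\sigma(x,\xi)e^{iz\cdot\xi}\,d\xi$ be the kernel-distribution of $\sigma$, that is, for every $x$, $\langle k(x,\cdot),\varphi\rangle=(2\pi)^{-n}\int\sigma(x,\xi)\big(\int e^{iz\cdot\xi}\varphi(z)\,dz\big)d\xi$ for test functions $\varphi$. Then on $\{z\ne0\}$ the distribution $k$ is a $C^\infty$ function of $(x,z)$ (when $\sigma(x,\cdot)$ is integrable, the value $k(x,0)$ is understood as the absolutely convergent integral), and the following hold. (i) For all $\alpha,\beta\in\mathbb N^n$ and all real $N>0$ there is a constant $C=C_{\alpha,\beta,N}$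 such that for all $x\in\mathbb R^n$ and all $|z|\ge\frac12$, $$|\partial_x^\alpha\partial_z^\beta k(x,z)|\le C(1+|z|)^{-N}.$$ (ii) Let $\alpha\in\mathbb N$, $\beta\in\mathbb N^n$, and let $N\ge0$ be an integer, or, if $\rho\le1$, any real number $N\ge 0$. If $$n+m+\delta\alpha+\max(1,\rho)|\beta|<N\rho,$$ then there is a constant $C=C_{\alpha,\beta,N}$ such that for all $z$ with $|z|\le\frac12$ ($z\neq0$ unless $N=0$), $$\|\partial_z^\beta k(\cdot,z)\|_{B^{\alpha,\infty}_\infty(\mathbb R^n)}\le C|z|^{-N},$$ where $B^{\alpha,\infty}_\infty(\mathbb R^n)$ is the inhomogeneous Besov space, with norm $\sup_{j\ge0}2^{j\alpha}\|\Delta_jf\|_{L^\infty}$ for a dyadic Littlewood–Paley decomposition $f=\sum_{j\ge0}\Delta_jf$. -/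

import Mathlib

open MeasureTheory
open scoped ContDiff FourierTransform ENNReal Real InnerProductSpace

/-- The partial derivative `∂f/∂x_i` of a complex-valued function on `ℝⁿ`. -/
noncomputable def coordDeriv {n : ℕ} (i : Fin n) (f : EuclideanSpace ℝ (Fin n) → ℂ) :
    EuclideanSpace ℝ (Fin n) → ℂ :=
  fun x => fderiv ℝ f x (EuclideanSpace.single i (1 : ℝ))

/-- The derivative `∂^α f = ∂_1^{α_1} ⋯ ∂_n^{α_n} f` for a multi-index `α ∈ ℕⁿ`. -/
noncomputable def multiDeriv {n : ℕ} (α : Fin n → ℕ) (f : EuclideanSpace ℝ (Fin n) → ℂ) :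
    EuclideanSpace ℝ (Fin n) → ℂ :=
  (List.finRange n).foldr (fun i g => (coordDeriv i)^[α i] g) f

/-- The length `|α| = α_1 + ⋯ + α_n` of a multi-index. -/
def multiLength {n : ℕ} (α : Fin n → ℕ) : ℕ := ∑ i, α i

/-- The mixed derivative `∂_x^α ∂_y^β g` of a function `g(x, y)` on `ℝⁿ × ℝⁿ`. -/
noncomputable def mixedDeriv {n : ℕ} (α β : Fin n → ℕ)
    (g : EuclideanSpace ℝ (Fin n) → EuclideanSpace ℝ (Fin n) → ℂ)
    (x y : EuclideanSpace ℝ (Fin n)) : ℂ :=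
  multiDeriv α (fun x' => multiDeriv β (g x') y) x

/-- Hörmander's symbol class `S^m_{ρ,δ}` on `ℝⁿ × ℝⁿ`: smooth functions `σ(x, ξ)` such that
`|∂_x^α ∂_ξ^β σ(x, ξ)| ≤ C_{α,β} (1 + |ξ|)^{m - ρ|β| + δ|α|}` for all multi-indices. -/
structure IsHormanderSymbol {n : ℕ} (m ρ δ : ℝ)
    (σ : EuclideanSpace ℝ (Fin n) → EuclideanSpace ℝ (Fin n) → ℂ) : Prop where
  smooth : ContDiff ℝ ∞ (fun p : EuclideanSpace ℝ (Fin n) × EuclideanSpace ℝ (Fin n) =>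
    σ p.1 p.2)
  bound : ∀ α β : Fin n → ℕ, ∃ C : ℝ, ∀ x ξ,
    ‖mixedDeriv α β σ x ξ‖ ≤
      C * (1 + ‖ξ‖) ^ (m - ρ * (multiLength β : ℝ) + δ * (multiLength α : ℝ))

/-- The pairing `⟨k(x, ·), φ⟩` of the kernel-distribution
`k(x, z) = (2π)^{-n} ∫ σ(x, ξ) e^{i z·ξ} dξ` with a test function `φ`, that is
`(2π)^{-n} ∫ σ(x, ξ) (∫ e^{i z·ξ} φ(z) dz) dξ`. -/
noncomputable def kernelPairing {n : ℕ}
    (σ : EuclideanSpace ℝ (Fin n) → EuclideanSpace ℝ (Fin n) → ℂ)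
    (x : EuclideanSpace ℝ (Fin n)) (φ : EuclideanSpace ℝ (Fin n) → ℂ) : ℂ :=
  (((2 * π) ^ n)⁻¹ : ℝ) *
    ∫ ξ, σ x ξ * ∫ z, Complex.exp (Complex.I * (⟪z, ξ⟫_ℝ : ℝ)) * φ z

/-- `k` is the kernel `k(x, z) = (2π)^{-n} ∫ σ(x, ξ) e^{i z·ξ} dξ` of the symbol `σ`, as a
function: `k` is smooth off `z = 0` and coincides there with the kernel-distribution; wherever
the integral converges absolutely (even at `z = 0`), `k` is given by the integral. By continuity,
the values of `k` at `z ≠ 0` are uniquely determined by `σ`. -/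
structure IsSymbolKernel {n : ℕ}
    (σ k : EuclideanSpace ℝ (Fin n) → EuclideanSpace ℝ (Fin n) → ℂ) : Prop where
  smooth : ContDiffOn ℝ ∞
    (fun p : EuclideanSpace ℝ (Fin n) × EuclideanSpace ℝ (Fin n) => k p.1 p.2) {p | p.2 ≠ 0}
  pairing : ∀ (x : EuclideanSpace ℝ (Fin n)) (φ : EuclideanSpace ℝ (Fin n) → ℂ),
    ContDiff ℝ ∞ φ → HasCompactSupport φ → 0 ∉ tsupport φ →
      ∫ z, k x z * φ z = kernelPairing σ x φ
  integral : ∀ x z : EuclideanSpace ℝ (Fin n), Integrable (σ x) →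
    k x z = (((2 * π) ^ n)⁻¹ : ℝ) *
      ∫ ξ, σ x ξ * Complex.exp (Complex.I * (⟪z, ξ⟫_ℝ : ℝ))

/-- A smooth cutoff on `ℝⁿ` that is `1` on the closed unit ball and supported in the ball of
radius `2`. -/
noncomputable def lpBump (n : ℕ) : ContDiffBump (0 : EuclideanSpace ℝ (Fin n)) :=
  ⟨1, 2, one_pos, one_lt_two⟩

/-- The inhomogeneous dyadic resolution of unity `χ_0 + χ_1 + χ_2 + ⋯ = 1`, with `χ_j` supported
in `2^{j-1} ≤ |ξ| ≤ 2^{j+1}` for `j ≥ 1`. -/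
noncomputable def dyadicCutoff {n : ℕ} : ℕ → EuclideanSpace ℝ (Fin n) → ℝ
  | 0, ξ => lpBump n ξ
  | j + 1, ξ => lpBump n (((2 : ℝ) ^ (j + 1))⁻¹ • ξ) - lpBump n (((2 : ℝ) ^ j)⁻¹ • ξ)

/-- The dyadic block `Δ_j f = (𝓕⁻¹ χ_j) * f`, for `f` a tempered function. -/
noncomputable def dyadicBlock {n : ℕ} (j : ℕ) (f : EuclideanSpace ℝ (Fin n) → ℂ) :
    EuclideanSpace ℝ (Fin n) → ℂ :=
  fun x => ∫ y, 𝓕⁻ (fun ξ : EuclideanSpace ℝ (Fin n) => (dyadicCutoff j ξ : ℂ)) (x - y) * f y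

/-- `f` is a tempered function: it is locally integrable and defines a tempered distribution
through `∫ |f(x)| (1 + |x|)^{-K} dx < ∞` for some `K`. -/
def IsTemperedFunction {n : ℕ} (f : EuclideanSpace ℝ (Fin n) → ℂ) : Prop :=
  ∃ K : ℕ, Integrable (fun x => (((1 + ‖x‖) ^ K)⁻¹ : ℝ) • f x)

open Classical in
/-- The norm `sup_{j ≥ 0} 2^{js} ‖Δ_j f‖_{L^∞}` of a function `f` in the (inhomogeneous) Besov
space `B^{s,∞}_∞(ℝⁿ)`, with value `∞` if `f` is not in the space. -/
noncomputable def besovNorm {n : ℕ} (s : ℝ) (f : EuclideanSpace ℝ (Fin n) → ℂ) : ℝ≥0∞ :=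
  if IsTemperedFunction f then
    ⨆ j : ℕ, ENNReal.ofReal ((2 : ℝ) ^ ((j : ℝ) * s)) * eLpNorm (dyadicBlock j f) ⊤ volume
  else ⊤

/-! For z ≠ 0 write K(a)(x, z) for the oscillatory integral (2π)^{-n} ∫ a(x, ξ) e^{iz·ξ} dξ.
Integration by parts gives -i z_j K(a) = K(∂_{ξ_j} a), and the weights w_j = i z_j/|z|² satisfy ∑
w_j (-i z_j) = 1. Hence K(a) = ∑ w_j K(∂_{ξ_j} a) (`oscKernel_eq_sum`): each use costs a factor
|z|^{-1} and lowers the order of the symbol by ρ. As ρ > 0, finitely many uses bring the order below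
-n, where the integral converges absolutely. This defines K (`oscKernel_eq_regOsc`) and bounds it by
|z|^{-M} once m - ρM < -n (`norm_oscKernel_le`).

Derivatives of K are again kernels of symbols: ∂_x raises the order by δ, and ∂_z, which multiplies
the symbol by iξ, raises it by max(1, ρ). This gives smoothness off z = 0, and (i) follows because M
may be taken arbitrarily large.

In (ii) the same bound settles integer N. If ρ ≤ 1, whole integrations by parts reduce a real N to 0
≤ N ≤ 1. Shifting ξ by the half period h = πz/|z|² flips the sign of the wave, so K(a) is -1/2 times
the integral of the increment a(ξ + h) - a(ξ) against the wave. Interpolating the size and mean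
value bounds for the increment costs |h|^N, comparable to |z|^{-N}, and lowers the order by Nρ
(`norm_oscKernel_le_rpow`). Since the Besov index is a natural number, it remains to bound that many
x-derivatives: they control the norm because a cutoff vanishing near the origin is ∑ ξ_j ψ_j, and
each ξ_j moves onto the function as a derivative (`besovNorm_le_of_hasBoundedDerivs`).

K represents the kernel-distribution off the origin by the dual argument: a test function supported
away from 0 is ∑ z_j ψ_j, which trades z_j for i∂_{ξ_j} on both sides until Fubini applies
(`integral_oscKernel_mul`). -/

/-! ### Words in families of operators. -/

section OperatorWords

variable {ι X Y : Type*}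

/-- A map intertwining two families of operators on an invariant set intertwines the iterated
compositions of these operators. -/
theorem foldr_iterate_semiconj {P : X → Prop} {D : ι → X → X} {D' : ι → Y → Y} {T : X → Y}
    (hP : ∀ i f, P f → P (D i f)) (hT : ∀ i f, P f → T (D i f) = D' i (T f))
    (α : ι → ℕ) (l : List ι) {f : X} (hf : P f) :
    P (l.foldr (fun i g => (D i)^[α i] g) f) ∧
      T (l.foldr (fun i g => (D i)^[α i] g) f) = l.foldr (fun i g => (D' i)^[α i] g) (T f) := by
  have iter : ∀ (i : ι) (k : ℕ) (f : X), P f →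
      P ((D i)^[k] f) ∧ T ((D i)^[k] f) = (D' i)^[k] (T f) := by
    intro i k
    induction k with
    | zero => intro f hf; exact ⟨hf, rfl⟩
    | succ k ih =>
      intro f hf
      have := ih _ (hP i f hf)
      simp only [Function.iterate_succ_apply]
      exact ⟨this.1, by rw [this.2, hT i f hf]⟩
  induction l with
  | nil => exact ⟨hf, rfl⟩
  | cons i l ih =>
    have := iter i (α i) _ ih.1
    simp only [List.foldr_cons]
    exact ⟨this.1, by rw [this.2, ih.2]⟩

/-- Multi-index derivatives are ordered words, so an extra letter has to commute past the block of
its own index and everything applied before that block. -/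
theorem foldr_iterate_add_single [DecidableEq ι] {P : X → Prop} {D : ι → X → X}
    (hP : ∀ i f, P f → P (D i f)) (hc : ∀ i j f, P f → D i (D j f) = D j (D i f))
    (α : ι → ℕ) (i : ι) {l : List ι} (hl : l.Nodup) (hi : i ∈ l) {f : X} (hf : P f) :
    l.foldr (fun j g => (D j)^[(α + Pi.single i 1 : ι → ℕ) j] g) f =
      l.foldr (fun j g => (D j)^[α j] g) (D i f) := by
  have notMem : ∀ (l : List ι) (f : X), i ∉ l →
      l.foldr (fun j g => (D j)^[(α + Pi.single i 1 : ι → ℕ) j] g) f =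
        l.foldr (fun j g => (D j)^[α j] g) f := by
    intro l f h
    induction l with
    | nil => rfl
    | cons j l ih =>
      simp only [List.mem_cons, not_or] at h
      simp only [List.foldr_cons, ih h.2]
      rw [Pi.add_apply, Pi.single_eq_of_ne (Ne.symm h.1), add_zero]
  induction l with
  | nil => simp at hi
  | cons j l ih =>
    simp only [List.foldr_cons]
    by_cases hij : i = j
    · subst hij
      rw [notMem l f (List.nodup_cons.1 hl).1, Pi.add_apply, Pi.single_eq_same,
        Function.iterate_succ_apply]
      congr 1
      exact (foldr_iterate_semiconj (T := D i) hP (fun j f h => hc i j f h) α l hf).2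
    · have hil : i ∈ l := by simpa [hij] using hi
      rw [ih (List.nodup_cons.1 hl).2 hil, Pi.add_apply, Pi.single_eq_of_ne (Ne.symm hij), add_zero]

end OperatorWords

/-! ### Calculus of multi-index derivatives. -/

section CoordDeriv

variable {n : ℕ}

local notation "𝔼" => EuclideanSpace ℝ (Fin n)

theorem ContDiff.coordDeriv {f : 𝔼 → ℂ} (hf : ContDiff ℝ ∞ f) (i : Fin n) :
    ContDiff ℝ ∞ (coordDeriv i f) :=
  (hf.fderiv_right (m := ∞) le_rfl).clm_apply contDiff_const

theorem fderiv_apply_comm {V : Type*} [NormedAddCommGroup V] [NormedSpace ℝ V] {f : V → ℂ}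
    (hf : ContDiff ℝ ∞ f) (v w : V) (x : V) :
    fderiv ℝ (fun y => fderiv ℝ f y w) x v = fderiv ℝ (fun y => fderiv ℝ f y v) x w := by
  have hd : DifferentiableAt ℝ (fderiv ℝ f) x :=
    ((hf.fderiv_right (m := ∞) le_rfl).differentiable (by simp)) x
  have hs : IsSymmSndFDerivAt ℝ f x :=
    hf.contDiffAt.isSymmSndFDerivAt
      (by simpa [minSmoothness_of_isRCLikeNormedField] using ENat.LEInfty.out)
  rw [fderiv_clm_apply hd (differentiableAt_const _),
    fderiv_clm_apply hd (differentiableAt_const _)]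
  simpa using hs v w

theorem coordDeriv_comm {f : 𝔼 → ℂ} (hf : ContDiff ℝ ∞ f) (i j : Fin n) :
    coordDeriv i (coordDeriv j f) = coordDeriv j (coordDeriv i f) :=
  funext fun x => fderiv_apply_comm hf _ _ x

theorem coordDeriv_add {f g : 𝔼 → ℂ} (hf : ContDiff ℝ ∞ f) (hg : ContDiff ℝ ∞ g) (i : Fin n) :
    coordDeriv i (f + g) = coordDeriv i f + coordDeriv i g := by
  funext x
  simp only [coordDeriv, Pi.add_apply]
  rw [fderiv_add (hf.differentiable (by simp) x) (hg.differentiable (by simp) x)]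
  rfl

theorem coordDeriv_const_mul {f : 𝔼 → ℂ} (hf : ContDiff ℝ ∞ f) (c : ℂ) (i : Fin n) :
    coordDeriv i (fun x => c * f x) = fun x => c * coordDeriv i f x := by
  funext x
  simp only [coordDeriv]
  rw [fderiv_const_mul (hf.differentiable (by simp) x)]
  rfl

theorem ContDiff.multiDeriv {f : 𝔼 → ℂ} (hf : ContDiff ℝ ∞ f) (α : Fin n → ℕ) :
    ContDiff ℝ ∞ (multiDeriv α f) :=
  (foldr_iterate_semiconj (P := ContDiff ℝ ∞) (T := id) (fun i _ h => h.coordDeriv i)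
    (fun _ _ _ => rfl) α _ hf).1

theorem multiDeriv_add_single {f : 𝔼 → ℂ} (hf : ContDiff ℝ ∞ f) (α : Fin n → ℕ) (i : Fin n) :
    multiDeriv (α + Pi.single i 1) f = multiDeriv α (coordDeriv i f) :=
  foldr_iterate_add_single (P := ContDiff ℝ ∞) (fun i _ h => h.coordDeriv i)
    (fun i j _ h => coordDeriv_comm h i j) α i (List.nodup_finRange n) (List.mem_finRange i) hf

theorem multiDeriv_zero (f : 𝔼 → ℂ) : multiDeriv 0 f = f := by
  unfold multiDeriv
  induction List.finRange n with
  | nil => rfl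
  | cons i l ih => simp

theorem multiDeriv_add {f g : 𝔼 → ℂ} (hf : ContDiff ℝ ∞ f) (hg : ContDiff ℝ ∞ g)
    (α : Fin n → ℕ) : multiDeriv α (f + g) = multiDeriv α f + multiDeriv α g := by
  -- The operators act diagonally on pairs (f, g); the sum and both projections intertwine this
  -- action with differentiation.
  have h1 := foldr_iterate_semiconj
    (P := fun p : (𝔼 → ℂ) × (𝔼 → ℂ) => ContDiff ℝ ∞ p.1 ∧ ContDiff ℝ ∞ p.2)
    (D := fun i p => (coordDeriv i p.1, coordDeriv i p.2)) (D' := coordDeriv)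
    (T := fun p => p.1 + p.2) (fun i p h => ⟨h.1.coordDeriv i, h.2.coordDeriv i⟩)
    (fun i p h => (coordDeriv_add h.1 h.2 i).symm) α (List.finRange n) (f := (f, g)) ⟨hf, hg⟩
  have h2 := foldr_iterate_semiconj (P := fun _ : (𝔼 → ℂ) × (𝔼 → ℂ) => True)
    (D := fun i p => (coordDeriv i p.1, coordDeriv i p.2)) (D' := coordDeriv)
    (T := Prod.fst) (fun _ _ _ => trivial) (fun _ _ _ => rfl) α (List.finRange n) (f := (f, g))
    trivial
  have h3 := foldr_iterate_semiconj (P := fun _ : (𝔼 → ℂ) × (𝔼 → ℂ) => True)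
    (D := fun i p => (coordDeriv i p.1, coordDeriv i p.2)) (D' := coordDeriv)
    (T := Prod.snd) (fun _ _ _ => trivial) (fun _ _ _ => rfl) α (List.finRange n) (f := (f, g))
    trivial
  unfold multiDeriv
  rw [← h1.2, ← h2.2, ← h3.2]

theorem multiDeriv_const_mul {f : 𝔼 → ℂ} (hf : ContDiff ℝ ∞ f) (c : ℂ) (α : Fin n → ℕ) :
    multiDeriv α (fun x => c * f x) = fun x => c * multiDeriv α f x :=
  (foldr_iterate_semiconj (P := ContDiff ℝ ∞) (T := fun (f : 𝔼 → ℂ) x => c * f x)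
    (fun i _ h => h.coordDeriv i) (fun i _ h => (coordDeriv_const_mul h c i).symm) α _ hf).2.symm

theorem multiLength_add_single (α : Fin n → ℕ) (i : Fin n) :
    multiLength (α + Pi.single i 1) = multiLength α + 1 := by
  simp [multiLength, Finset.sum_add_distrib]

theorem exists_eq_add_single {α : Fin n → ℕ} {k : ℕ} (h : multiLength α = k + 1) :
    ∃ (β : Fin n → ℕ) (i : Fin n), α = β + Pi.single i 1 ∧ multiLength β = k := by
  obtain ⟨i, hi⟩ : ∃ i, α i ≠ 0 := by
    by_contra! h0
    simp [multiLength, h0] at h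
  have hα : α = (α - Pi.single i 1) + Pi.single i 1 := by
    funext j
    rcases eq_or_ne j i with rfl | hj
    · simp; omega
    · simp [hj]
  refine ⟨α - Pi.single i 1, i, hα, ?_⟩
  rw [hα, multiLength_add_single] at h
  omega

end CoordDeriv

/-! ### Symbol classes under differentiation and multiplication by ξ_j. -/

section Symbols

variable {n : ℕ} {m ρ δ : ℝ}

local notation "𝔼" => EuclideanSpace ℝ (Fin n)

/-- The derivative `∂a/∂x_i` of a symbol `a(x, ξ)`. -/
noncomputable def spaceDeriv (i : Fin n) (a : 𝔼 → 𝔼 → ℂ) : 𝔼 → 𝔼 → ℂ :=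
  fun x ξ => coordDeriv i (fun x' => a x' ξ) x

/-- The derivative `∂a/∂ξ_i` of a symbol `a(x, ξ)`. -/
noncomputable def freqDeriv (i : Fin n) (a : 𝔼 → 𝔼 → ℂ) : 𝔼 → 𝔼 → ℂ :=
  fun x => coordDeriv i (a x)

/-- Joint smoothness of a function `a(x, ξ)`. -/
def JointlySmooth (a : 𝔼 → 𝔼 → ℂ) : Prop := ContDiff ℝ ∞ (fun p : 𝔼 × 𝔼 => a p.1 p.2)

theorem JointlySmooth.left {a : 𝔼 → 𝔼 → ℂ} (ha : JointlySmooth a) (ξ : 𝔼) :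
    ContDiff ℝ ∞ (fun x => a x ξ) :=
  ContDiff.comp ha (contDiff_id.prodMk contDiff_const)

theorem JointlySmooth.right {a : 𝔼 → 𝔼 → ℂ} (ha : JointlySmooth a) (x : 𝔼) :
    ContDiff ℝ ∞ (a x) :=
  ContDiff.comp (g := fun p : 𝔼 × 𝔼 => a p.1 p.2) ha (contDiff_const.prodMk contDiff_id)

/-- Seen as directional derivatives of one function on the product, the x- and ξ-derivatives inherit
joint smoothness, and their commutation is symmetry of the second derivative. -/
theorem spaceDeriv_eq_fderiv {a : 𝔼 → 𝔼 → ℂ} (ha : JointlySmooth a) (i : Fin n) (x ξ : 𝔼) :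
    spaceDeriv i a x ξ =
      fderiv ℝ (fun p : 𝔼 × 𝔼 => a p.1 p.2) (x, ξ) (EuclideanSpace.single i 1, 0) := by
  have h : HasFDerivAt (fun x' => a x' ξ) _ x :=
    HasFDerivAt.comp (g := fun p : 𝔼 × 𝔼 => a p.1 p.2) x
      (ContDiff.differentiable ha (by simp) (x, ξ)).hasFDerivAt
      ((hasFDerivAt_id (𝕜 := ℝ) x).prodMk (hasFDerivAt_const ξ x))
  simp only [spaceDeriv, coordDeriv]
  rw [h.fderiv]
  simp

theorem freqDeriv_eq_fderiv {a : 𝔼 → 𝔼 → ℂ} (ha : JointlySmooth a) (i : Fin n) (x ξ : 𝔼) :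
    freqDeriv i a x ξ =
      fderiv ℝ (fun p : 𝔼 × 𝔼 => a p.1 p.2) (x, ξ) (0, EuclideanSpace.single i 1) := by
  have h : HasFDerivAt (a x) _ ξ :=
    (ContDiff.differentiable ha (by simp) (x, ξ)).hasFDerivAt.comp ξ
      ((hasFDerivAt_const x ξ).prodMk (hasFDerivAt_id (𝕜 := ℝ) ξ))
  simp only [freqDeriv, coordDeriv]
  rw [h.fderiv]
  simp

theorem JointlySmooth.spaceDeriv {a : 𝔼 → 𝔼 → ℂ} (ha : JointlySmooth a) (i : Fin n) :
    JointlySmooth (spaceDeriv i a) := by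
  unfold JointlySmooth
  simp only [spaceDeriv_eq_fderiv ha]
  exact (ContDiff.fderiv_right (m := ∞) ha le_rfl).clm_apply contDiff_const

theorem JointlySmooth.freqDeriv {a : 𝔼 → 𝔼 → ℂ} (ha : JointlySmooth a) (i : Fin n) :
    JointlySmooth (freqDeriv i a) := by
  unfold JointlySmooth
  simp only [freqDeriv_eq_fderiv ha]
  exact (ContDiff.fderiv_right (m := ∞) ha le_rfl).clm_apply contDiff_const

theorem spaceDeriv_freqDeriv {a : 𝔼 → 𝔼 → ℂ} (ha : JointlySmooth a) (i j : Fin n) :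
    spaceDeriv i (freqDeriv j a) = freqDeriv j (spaceDeriv i a) := by
  funext x ξ
  rw [spaceDeriv_eq_fderiv (ha.freqDeriv j), freqDeriv_eq_fderiv (ha.spaceDeriv i)]
  simp only [spaceDeriv_eq_fderiv ha, freqDeriv_eq_fderiv ha]
  exact fderiv_apply_comm ha _ _ _

theorem freqDeriv_comm {a : 𝔼 → 𝔼 → ℂ} (ha : JointlySmooth a) (i j : Fin n) :
    freqDeriv i (freqDeriv j a) = freqDeriv j (freqDeriv i a) :=
  funext fun x => coordDeriv_comm (ha.right x) i j

theorem foldr_freqDeriv_apply (a : 𝔼 → 𝔼 → ℂ) (β : Fin n → ℕ) (x : 𝔼) :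
    (List.finRange n).foldr (fun i g => (freqDeriv i)^[β i] g) a x = multiDeriv β (a x) :=
  (foldr_iterate_semiconj (P := fun _ => True) (T := fun a : 𝔼 → 𝔼 → ℂ => a x)
    (fun _ _ _ => trivial) (fun _ _ _ => rfl) β _ trivial).2

theorem JointlySmooth.multiDeriv {a : 𝔼 → 𝔼 → ℂ} (ha : JointlySmooth a) (β : Fin n → ℕ) :
    JointlySmooth (fun x => multiDeriv β (a x)) := by
  have := (foldr_iterate_semiconj (P := JointlySmooth) (T := id) (fun i _ h => h.freqDeriv i)
    (fun _ _ _ => rfl) β (List.finRange n) ha).1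
  rwa [funext (foldr_freqDeriv_apply a β)] at this

theorem mixedDeriv_spaceDeriv {a : 𝔼 → 𝔼 → ℂ} (ha : JointlySmooth a) (α β : Fin n → ℕ)
    (i : Fin n) :
    mixedDeriv α β (spaceDeriv i a) = mixedDeriv (α + Pi.single i 1) β a := by
  have h := (foldr_iterate_semiconj (P := JointlySmooth) (T := spaceDeriv i)
    (fun i _ h => h.freqDeriv i) (fun j _ h => spaceDeriv_freqDeriv h i j) β (List.finRange n)
    ha).2
  funext x ξ
  unfold mixedDeriv
  rw [multiDeriv_add_single ((ha.multiDeriv β).left ξ)]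
  congr 1
  funext x'
  rw [← foldr_freqDeriv_apply, ← h, funext (foldr_freqDeriv_apply a β)]
  rfl

theorem mixedDeriv_freqDeriv {a : 𝔼 → 𝔼 → ℂ} (ha : JointlySmooth a) (α β : Fin n → ℕ)
    (i : Fin n) :
    mixedDeriv α β (freqDeriv i a) = mixedDeriv α (β + Pi.single i 1) a := by
  funext x ξ
  unfold mixedDeriv
  simp only [multiDeriv_add_single (ha.right _)]
  rfl

theorem mixedDeriv_add {a b : 𝔼 → 𝔼 → ℂ} (ha : JointlySmooth a) (hb : JointlySmooth b)
    (α β : Fin n → ℕ) : mixedDeriv α β (a + b) = mixedDeriv α β a + mixedDeriv α β b := by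
  funext x ξ
  have h := congrFun (multiDeriv_add ((ha.multiDeriv β).left ξ) ((hb.multiDeriv β).left ξ) α) x
  simp only [mixedDeriv, Pi.add_apply, multiDeriv_add (ha.right _) (hb.right _)]
  exact h

theorem mixedDeriv_const_mul {a : 𝔼 → 𝔼 → ℂ} (ha : JointlySmooth a) (c : ℂ)
    (α β : Fin n → ℕ) :
    mixedDeriv α β (fun x ξ => c * a x ξ) = fun x ξ => c * mixedDeriv α β a x ξ := by
  funext x ξ
  have h := congrFun (multiDeriv_const_mul ((ha.multiDeriv β).left ξ) c α) x
  simp only [mixedDeriv, multiDeriv_const_mul (ha.right _)]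
  exact h

theorem freqDeriv_coord_mul {a : 𝔼 → 𝔼 → ℂ} (ha : JointlySmooth a) (i j : Fin n) :
    freqDeriv i (fun x ξ => (ξ j : ℂ) * a x ξ) =
      (fun x ξ => (ξ j : ℂ) * freqDeriv i a x ξ) + fun x ξ => (if i = j then 1 else 0) * a x ξ := by
  funext x ξ
  have h1 : HasFDerivAt (fun ξ : 𝔼 => (ξ j : ℂ))
      (Complex.ofRealCLM ∘L (EuclideanSpace.proj j : 𝔼 →L[ℝ] ℝ)) ξ :=
    (Complex.ofRealCLM ∘L (EuclideanSpace.proj j : 𝔼 →L[ℝ] ℝ)).hasFDerivAt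
  have h2 := ((ha.right x).differentiable (by simp) ξ).hasFDerivAt
  have h3 : HasFDerivAt (fun ξ : 𝔼 => (ξ j : ℂ) * a x ξ) _ ξ := h1.mul h2
  simp only [freqDeriv, coordDeriv, Pi.add_apply]
  rw [h3.fderiv]
  by_cases hij : i = j
  · subst hij; simp
  · simp [hij, Ne.symm hij]

theorem JointlySmooth.coord_mul {a : 𝔼 → 𝔼 → ℂ} (ha : JointlySmooth a) (j : Fin n) :
    JointlySmooth (fun x ξ => (ξ j : ℂ) * a x ξ) := by
  refine ContDiff.mul ?_ ha
  exact (Complex.ofRealCLM ∘L (EuclideanSpace.proj j : 𝔼 →L[ℝ] ℝ) ∘L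
    ContinuousLinearMap.snd ℝ 𝔼 𝔼).contDiff

theorem JointlySmooth.const_mul {a : 𝔼 → 𝔼 → ℂ} (ha : JointlySmooth a) (c : ℂ) :
    JointlySmooth (fun x ξ => c * a x ξ) :=
  ContDiff.mul contDiff_const ha

namespace IsHormanderSymbol

variable {a : EuclideanSpace ℝ (Fin n) → EuclideanSpace ℝ (Fin n) → ℂ}

theorem jointlySmooth (ha : IsHormanderSymbol m ρ δ a) : JointlySmooth a := ha.smooth

theorem spaceDeriv (ha : IsHormanderSymbol m ρ δ a) (i : Fin n) :
    IsHormanderSymbol (m + δ) ρ δ (spaceDeriv i a) := by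
  refine ⟨ha.jointlySmooth.spaceDeriv i, fun α β => ?_⟩
  obtain ⟨C, hC⟩ := ha.bound (α + Pi.single i 1) β
  refine ⟨C, fun x ξ => ?_⟩
  rw [mixedDeriv_spaceDeriv ha.jointlySmooth]
  refine (hC x ξ).trans_eq ?_
  rw [multiLength_add_single]
  push_cast
  ring_nf

theorem freqDeriv (ha : IsHormanderSymbol m ρ δ a) (i : Fin n) :
    IsHormanderSymbol (m - ρ) ρ δ (freqDeriv i a) := by
  refine ⟨ha.jointlySmooth.freqDeriv i, fun α β => ?_⟩
  obtain ⟨C, hC⟩ := ha.bound α (β + Pi.single i 1)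
  refine ⟨C, fun x ξ => ?_⟩
  rw [mixedDeriv_freqDeriv ha.jointlySmooth]
  refine (hC x ξ).trans_eq ?_
  rw [multiLength_add_single]
  push_cast
  ring_nf

theorem const_mul (ha : IsHormanderSymbol m ρ δ a) (c : ℂ) :
    IsHormanderSymbol m ρ δ (fun x ξ => c * a x ξ) := by
  refine ⟨ha.jointlySmooth.const_mul c, fun α β => ?_⟩
  obtain ⟨C, hC⟩ := ha.bound α β
  refine ⟨‖c‖ * C, fun x ξ => ?_⟩
  rw [mixedDeriv_const_mul ha.jointlySmooth, norm_mul, mul_assoc]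
  exact mul_le_mul_of_nonneg_left (hC x ξ) (norm_nonneg c)

theorem exists_bound_of_le {k e : ℝ} {f : 𝔼 → 𝔼 → ℂ} (he : k ≤ e)
    (hf : ∃ C : ℝ, ∀ x ξ, ‖f x ξ‖ ≤ C * (1 + ‖ξ‖) ^ k) :
    ∃ C : ℝ, ∀ x ξ, ‖f x ξ‖ ≤ C * (1 + ‖ξ‖) ^ e := by
  obtain ⟨C, hC⟩ := hf
  refine ⟨|C|, fun x ξ => (hC x ξ).trans ?_⟩
  have h1 : (1 : ℝ) ≤ 1 + ‖ξ‖ := by linarith [norm_nonneg ξ]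
  exact mul_le_mul (le_abs_self C) (Real.rpow_le_rpow_of_exponent_le h1 he) (by positivity)
    (abs_nonneg C)

/-- Multiplication by `ξ_j` maps `S^m` into `S^{m + max(1, ρ)}`. -/
theorem coord_mul (ha : IsHormanderSymbol m ρ δ a) (j : Fin n) :
    IsHormanderSymbol (m + max 1 ρ) ρ δ (fun x ξ => (ξ j : ℂ) * a x ξ) := by
  refine ⟨ha.jointlySmooth.coord_mul j, fun α β => ?_⟩
  -- Induction on |β| by the commutator ∂_i(ξ_j a) = ξ_j ∂_i a + δ_{ij} a. The base case needs a
  -- rise of at least 1, from |ξ_j| ≤ 1 + |ξ|. In the commutator term one derivative is spent on ξ_j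
  -- without any gain, which needs a rise of at least ρ.
  suffices H : ∀ (k : ℕ) (β : Fin n → ℕ), multiLength β = k → ∀ (m : ℝ) (a : 𝔼 → 𝔼 → ℂ),
      IsHormanderSymbol m ρ δ a → ∃ C : ℝ, ∀ x ξ,
        ‖mixedDeriv α β (fun x ξ => (ξ j : ℂ) * a x ξ) x ξ‖ ≤
          C * (1 + ‖ξ‖) ^ (m + max 1 ρ - ρ * (k : ℝ) + δ * (multiLength α : ℝ)) from
    H _ β rfl m a ha
  intro k
  induction k with
  | zero =>
    intro β hβ m a ha
    have hβ0 : β = 0 := by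
      funext i
      exact (Finset.sum_eq_zero_iff.1 hβ) i (Finset.mem_univ i)
    subst hβ0
    obtain ⟨C, hC⟩ := ha.bound α 0
    refine exists_bound_of_le (k := 1 + (m + δ * (multiLength α : ℝ)))
      (by have := le_max_left 1 ρ; push_cast; linarith) ⟨C, fun x ξ => ?_⟩
    have h := congrFun (multiDeriv_const_mul (ha.jointlySmooth.left ξ) (ξ j : ℂ) α) x
    have hC' := hC x ξ
    simp only [mixedDeriv, multiDeriv_zero] at hC' ⊢
    rw [h, norm_mul, Complex.norm_real, Real.rpow_add (by positivity), Real.rpow_one]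
    have h1 : ‖ξ j‖ ≤ 1 + ‖ξ‖ := (PiLp.norm_apply_le ξ j).trans (by linarith)
    have h2 : m - ρ * (multiLength (0 : Fin n → ℕ) : ℝ) + δ * (multiLength α : ℝ) =
        m + δ * (multiLength α : ℝ) := by simp [multiLength]
    rw [h2] at hC'
    calc _ ≤ (1 + ‖ξ‖) * (C * (1 + ‖ξ‖) ^ (m + δ * (multiLength α : ℝ))) :=
          mul_le_mul h1 hC' (norm_nonneg _) (by positivity)
      _ = _ := by ring
  | succ k ih =>
    intro β hβ m a ha
    obtain ⟨β', i, rfl, hβ'⟩ := exists_eq_add_single hβ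
    obtain ⟨C₁, h₁⟩ := ih β' hβ' (m - ρ) _ (ha.freqDeriv i)
    obtain ⟨C₂, h₂⟩ := exists_bound_of_le
      (e := m + max 1 ρ - ρ * ((k + 1 : ℕ) : ℝ) + δ * (multiLength α : ℝ))
      (by rw [hβ']; have := le_max_right 1 ρ; push_cast; linarith)
      ((ha.const_mul (if i = j then 1 else 0)).bound α β')
    refine ⟨C₁ + C₂, fun x ξ => ?_⟩
    rw [← mixedDeriv_freqDeriv (ha.jointlySmooth.coord_mul j),
      freqDeriv_coord_mul ha.jointlySmooth,
      mixedDeriv_add ((ha.jointlySmooth.freqDeriv i).coord_mul j) (ha.jointlySmooth.const_mul _),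
      add_mul]
    refine (norm_add_le _ _).trans (add_le_add ?_ (h₂ x ξ))
    refine (h₁ x ξ).trans_eq ?_
    push_cast
    ring_nf

theorem norm_le (ha : IsHormanderSymbol m ρ δ a) :
    ∃ C : ℝ, 0 ≤ C ∧ ∀ x ξ, ‖a x ξ‖ ≤ C * (1 + ‖ξ‖) ^ m := by
  obtain ⟨C, hC⟩ := ha.bound 0 0
  refine ⟨|C|, abs_nonneg C, fun x ξ => ?_⟩
  have := hC x ξ
  simp only [mixedDeriv, multiDeriv_zero, multiLength, Pi.zero_apply, Finset.sum_const_zero,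
    Nat.cast_zero, mul_zero, sub_zero, add_zero] at this
  exact this.trans (mul_le_mul_of_nonneg_right (le_abs_self C) (by positivity))

theorem integrable (ha : IsHormanderSymbol m ρ δ a) (hm : m < -n) (x : 𝔼) :
    Integrable (a x) := by
  obtain ⟨C, -, hC⟩ := ha.norm_le
  have h := (integrable_one_add_norm (E := 𝔼) (μ := volume) (r := -m)
    (by rw [finrank_euclideanSpace_fin]; linarith)).const_mul C
  refine h.mono' (ha.jointlySmooth.right x).continuous.aestronglyMeasurable ?_
  exact Filter.Eventually.of_forall fun ξ => by simpa using hC x ξ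

end IsHormanderSymbol

end Symbols

/-! ### Absolutely convergent inverse Fourier integrals. -/

section OscillatoryIntegral

variable {n : ℕ}

local notation "𝔼" => EuclideanSpace ℝ (Fin n)

/-- The plane wave `e^{i z·ξ}`. -/
noncomputable def planeWave (z ξ : 𝔼) : ℂ := Complex.exp (Complex.I * (⟪z, ξ⟫_ℝ : ℝ))

/-- The inverse Fourier integral `(2π)^{-n} ∫ g(ξ) e^{i z·ξ} dξ`. -/
noncomputable def oscInt (g : 𝔼 → ℂ) (z : 𝔼) : ℂ :=
  (((2 * π) ^ n)⁻¹ : ℝ) * ∫ ξ, g ξ * planeWave z ξ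

theorem norm_planeWave (z ξ : 𝔼) : ‖planeWave z ξ‖ = 1 := by
  rw [planeWave, mul_comm, Complex.norm_exp_ofReal_mul_I]

theorem planeWave_comm (z ξ : 𝔼) : planeWave z ξ = planeWave ξ z := by
  rw [planeWave, planeWave, real_inner_comm]

theorem planeWave_add_right (z ξ η : 𝔼) :
    planeWave z (ξ + η) = planeWave z ξ * planeWave z η := by
  simp only [planeWave, inner_add_right, ← Complex.exp_add]
  push_cast
  ring_nf

theorem continuous_planeWave : Continuous (fun p : 𝔼 × 𝔼 => planeWave p.1 p.2) := by
  unfold planeWave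
  fun_prop

theorem continuous_planeWave_right (z : 𝔼) : Continuous (planeWave z) :=
  continuous_planeWave.comp (by fun_prop : Continuous fun ξ : 𝔼 => (z, ξ))

/-- The real-linear functional `v ↦ ∑_j c_j v_j`. -/
noncomputable def coordCLM (c : Fin n → ℂ) : 𝔼 →L[ℝ] ℂ :=
  ∑ j, c j • (Complex.ofRealCLM ∘L (EuclideanSpace.proj j : 𝔼 →L[ℝ] ℝ))

theorem coordCLM_apply (c : Fin n → ℂ) (v : 𝔼) : coordCLM c v = ∑ j, c j * (v j : ℂ) := by
  simp [coordCLM]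

theorem coordCLM_single (c : Fin n → ℂ) (i : Fin n) :
    coordCLM c (EuclideanSpace.single i 1) = c i := by
  rw [coordCLM_apply, Finset.sum_eq_single i] <;> simp +contextual

theorem eq_coordCLM (L : 𝔼 →L[ℝ] ℂ) :
    L = coordCLM fun j => L (EuclideanSpace.single j 1) := by
  refine ContinuousLinearMap.coe_injective
    ((EuclideanSpace.basisFun (Fin n) ℝ).toBasis.ext fun i => ?_)
  simp [coordCLM_single]

theorem HasFDerivAt.coordCLM {f : 𝔼 → ℂ} {L : 𝔼 →L[ℝ] ℂ} {x : 𝔼} (h : HasFDerivAt f L x)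
    {c : Fin n → ℂ} (hc : ∀ j, L (EuclideanSpace.single j 1) = c j) :
    HasFDerivAt f (coordCLM c) x := by
  rw [eq_coordCLM L, funext hc] at h
  exact h

theorem norm_coordCLM_le (c : Fin n → ℂ) : ‖coordCLM c‖ ≤ ∑ j, ‖c j‖ := by
  refine ContinuousLinearMap.opNorm_le_bound _ (by positivity) fun v => ?_
  rw [coordCLM_apply, Finset.sum_mul]
  refine (norm_sum_le _ _).trans (Finset.sum_le_sum fun j _ => ?_)
  rw [norm_mul, Complex.norm_real]
  exact mul_le_mul_of_nonneg_left (PiLp.norm_apply_le v j) (norm_nonneg _)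

theorem contDiff_coordCLM {r : ℕ∞ω} : ContDiff ℝ r (coordCLM : (Fin n → ℂ) → 𝔼 →L[ℝ] ℂ) := by
  unfold coordCLM
  fun_prop

/-- Differentiation under the integral sign, with all partial derivatives dominated. -/
theorem hasFDerivAt_integral_coord {F : 𝔼 → 𝔼 → ℂ} {G : Fin n → 𝔼 → 𝔼 → ℂ} {bound : 𝔼 → ℝ}
    (hF : ∀ x, Integrable (F x)) (hGm : ∀ j x, AEStronglyMeasurable (G j x) volume)
    (hG : ∀ j x ξ, ‖G j x ξ‖ ≤ bound ξ) (hb : Integrable bound)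
    (hd : ∀ ξ x, HasFDerivAt (fun x' => F x' ξ) (coordCLM fun j => G j x ξ) x) (x : 𝔼) :
    HasFDerivAt (fun x' => ∫ ξ, F x' ξ) (coordCLM fun j => ∫ ξ, G j x ξ) x := by
  have hGi : ∀ j, Integrable (G j x) := fun j =>
    hb.mono' (hGm j x) (Filter.Eventually.of_forall (hG j x))
  have hint : (coordCLM fun j => ∫ ξ, G j x ξ) = ∫ ξ, coordCLM fun j => G j x ξ := by
    unfold coordCLM
    rw [integral_finsetSum _ fun j _ => (hGi j).smul_const _]
    exact Finset.sum_congr rfl fun j _ => (integral_smul_const (G j x)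
      (Complex.ofRealCLM ∘L (EuclideanSpace.proj j : 𝔼 →L[ℝ] ℝ))).symm
  rw [hint]
  refine hasFDerivAt_integral_of_dominated_of_fderiv_le (bound := fun ξ => ∑ _j : Fin n, bound ξ)
    Filter.univ_mem (Filter.Eventually.of_forall fun x' => (hF x').aestronglyMeasurable) (hF x)
    ?_ (Filter.Eventually.of_forall fun ξ x' _ => ?_) (integrable_finsetSum _ fun _ _ => hb)
    (Filter.Eventually.of_forall fun ξ x' _ => hd ξ x')
  · exact (contDiff_coordCLM (r := 0)).continuous.comp_aestronglyMeasurable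
      (aemeasurable_pi_lambda _ fun j => (hGm j x).aemeasurable).aestronglyMeasurable
  · exact (norm_coordCLM_le _).trans (Finset.sum_le_sum fun j _ => hG j x' ξ)

theorem hasFDerivAt_planeWave (z ξ : 𝔼) :
    HasFDerivAt (fun z' => planeWave z' ξ)
      (coordCLM fun j => Complex.I * (ξ j : ℂ) * planeWave z ξ) z := by
  have h1 : HasFDerivAt (fun z' : 𝔼 => ((⟪z', ξ⟫_ℝ : ℝ) : ℂ))
      (Complex.ofRealCLM ∘L (innerSL ℝ ξ)) z := by
    have := (Complex.ofRealCLM ∘L (innerSL ℝ ξ)).hasFDerivAt (x := z)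
    refine this.congr_of_eventuallyEq (Filter.Eventually.of_forall fun z' => ?_)
    simp [real_inner_comm]
  have h2 : HasFDerivAt (fun z' => planeWave z' ξ) _ z := (h1.const_mul Complex.I).cexp
  refine h2.coordCLM fun j => ?_
  simp [planeWave, EuclideanSpace.inner_single_right]
  ring

theorem coordDeriv_planeWave (z ξ : 𝔼) (i : Fin n) :
    coordDeriv i (planeWave z) ξ = Complex.I * (z i : ℂ) * planeWave z ξ := by
  have h := hasFDerivAt_planeWave ξ z
  rw [show (fun z' => planeWave z' z) = planeWave z from funext fun _ => planeWave_comm _ _] at h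
  rw [coordDeriv, h.fderiv, coordCLM_single, planeWave_comm]

theorem differentiable_planeWave (z : 𝔼) : Differentiable ℝ (planeWave z) := fun ξ => by
  have h := hasFDerivAt_planeWave ξ z
  rw [show (fun z' => planeWave z' z) = planeWave z from funext fun _ => planeWave_comm _ _] at h
  exact h.differentiableAt

theorem MeasureTheory.Integrable.mul_planeWave {g : 𝔼 → ℂ} (hg : Integrable g) (z : 𝔼) :
    Integrable (fun ξ => g ξ * planeWave z ξ) :=
  hg.mul_bdd (c := 1) (continuous_planeWave_right z).aestronglyMeasurable
    (Filter.Eventually.of_forall fun ξ => (norm_planeWave z ξ).le)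

theorem oscInt_add {f g : 𝔼 → ℂ} (hf : Integrable f) (hg : Integrable g) (z : 𝔼) :
    oscInt (fun ξ => f ξ + g ξ) z = oscInt f z + oscInt g z := by
  simp only [oscInt, add_mul]
  rw [integral_add (hf.mul_planeWave z) (hg.mul_planeWave z), mul_add]

theorem oscInt_const_mul (c : ℂ) (g : 𝔼 → ℂ) (z : 𝔼) :
    oscInt (fun ξ => c * g ξ) z = c * oscInt g z := by
  simp only [oscInt, mul_assoc]
  rw [integral_const_mul]
  ring

theorem norm_oscInt_le (g : 𝔼 → ℂ) (z : 𝔼) :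
    ‖oscInt g z‖ ≤ ((2 * π) ^ n)⁻¹ * ∫ ξ, ‖g ξ‖ := by
  rw [oscInt, norm_mul, Complex.norm_real, Real.norm_of_nonneg (by positivity)]
  refine mul_le_mul_of_nonneg_left ((norm_integral_le_integral_norm _).trans_eq ?_) (by positivity)
  simp [norm_planeWave]

/-- Integration by parts: multiplication by `z_i` corresponds to `i ∂_i` on the frequency side. -/
theorem coord_mul_oscInt {g : 𝔼 → ℂ} (hd : Differentiable ℝ g) (hg : Integrable g) (i : Fin n)
    (hg' : Integrable (coordDeriv i g)) (z : 𝔼) :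
    (z i : ℂ) * oscInt g z = Complex.I * oscInt (coordDeriv i g) z := by
  have hw : ∀ ξ, g ξ * fderiv ℝ (planeWave z) ξ (EuclideanSpace.single i 1) =
      Complex.I * (z i : ℂ) * (g ξ * planeWave z ξ) := fun ξ => by
    have := coordDeriv_planeWave z ξ i
    rw [coordDeriv] at this
    rw [this]
    ring
  have h := integral_mul_fderiv_eq_neg_fderiv_mul_of_integrable (μ := volume) (f := g)
    (g := planeWave z) (v := EuclideanSpace.single i 1) (hg'.mul_planeWave z)
    (by simp only [hw]; exact (hg.mul_planeWave z).const_mul _) (hg.mul_planeWave z)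
    (fun x _ => hd x) (fun x _ => differentiable_planeWave z x)
  simp only [hw, integral_const_mul] at h
  have h' : (z i : ℂ) * ∫ ξ, g ξ * planeWave z ξ =
      Complex.I * ∫ ξ, coordDeriv i g ξ * planeWave z ξ := by
    have := congrArg (fun t => -Complex.I * t) h
    simp only [← mul_assoc, neg_mul, Complex.I_mul_I, neg_neg, one_mul, mul_neg] at this
    simpa [coordDeriv] using this
  rw [oscInt, oscInt, mul_left_comm, h']
  ring

theorem hasFDerivAt_oscInt {g : 𝔼 → ℂ} (hg : Integrable g)
    (hg' : Integrable fun ξ => ‖ξ‖ * ‖g ξ‖) (z : 𝔼) :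
    HasFDerivAt (oscInt g)
      (coordCLM fun j => oscInt (fun ξ => Complex.I * ((ξ j : ℂ) * g ξ)) z) z := by
  have h := hasFDerivAt_integral_coord (F := fun z ξ => g ξ * planeWave z ξ)
    (G := fun j z ξ => Complex.I * ((ξ j : ℂ) * g ξ) * planeWave z ξ)
    (bound := fun ξ => ‖ξ‖ * ‖g ξ‖) (fun z => hg.mul_planeWave z)
    (fun j z => (((by fun_prop : Continuous fun ξ : 𝔼 => (ξ j : ℂ)).aestronglyMeasurable.mul
      hg.aestronglyMeasurable).const_mul _).mul
        (continuous_planeWave_right z).aestronglyMeasurable)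
    (fun j z ξ => by
      simp only [norm_mul, norm_planeWave, Complex.norm_I, Complex.norm_real, one_mul, mul_one]
      exact mul_le_mul_of_nonneg_right (PiLp.norm_apply_le ξ j) (norm_nonneg _)) hg'
    (fun ξ z => by
      refine ((hasFDerivAt_planeWave z ξ).const_mul (g ξ)).coordCLM fun j => ?_
      rw [smul_apply, coordCLM_single, smul_eq_mul]
      ring) z
  have h' : HasFDerivAt (oscInt g) _ z := h.const_mul ((((2 * π) ^ n)⁻¹ : ℝ) : ℂ)
  refine h'.coordCLM fun j => ?_
  rw [smul_apply, coordCLM_single, smul_eq_mul]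
  rfl

variable {m ρ δ : ℝ}

theorem integrable_one_add_norm_rpow (hm : m < -n) :
    Integrable (fun ξ : 𝔼 => (1 + ‖ξ‖) ^ m) := by
  have h := integrable_one_add_norm (E := 𝔼) (μ := volume) (r := -m)
    (by rw [finrank_euclideanSpace_fin]; linarith)
  simpa using h

namespace IsHormanderSymbol

variable {a : EuclideanSpace ℝ (Fin n) → EuclideanSpace ℝ (Fin n) → ℂ}

theorem integrable_norm_mul (ha : IsHormanderSymbol m ρ δ a) (hm : m + max 1 ρ < -n) (x : 𝔼) :
    Integrable fun ξ => ‖ξ‖ * ‖a x ξ‖ := by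
  obtain ⟨C, hC0, hC⟩ := ha.norm_le
  refine ((integrable_one_add_norm_rpow hm).const_mul C).mono'
    (continuous_norm.mul (ha.jointlySmooth.right x).continuous.norm).aestronglyMeasurable
    (Filter.Eventually.of_forall fun ξ => ?_)
  have h1 : (1 : ℝ) ≤ 1 + ‖ξ‖ := by linarith [norm_nonneg ξ]
  rw [Real.norm_of_nonneg (by positivity)]
  calc ‖ξ‖ * ‖a x ξ‖ ≤ (1 + ‖ξ‖) ^ (1 : ℝ) * (C * (1 + ‖ξ‖) ^ m) := by
        rw [Real.rpow_one]
        exact mul_le_mul (by linarith) (hC x ξ) (norm_nonneg _) (by positivity)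
    _ = C * (1 + ‖ξ‖) ^ (m + 1) := by rw [Real.rpow_add (by positivity)]; ring
    _ ≤ C * (1 + ‖ξ‖) ^ (m + max 1 ρ) := by
        exact mul_le_mul_of_nonneg_left (Real.rpow_le_rpow_of_exponent_le h1
          (by linarith [le_max_left 1 ρ])) hC0

theorem hasFDerivAt_oscInt_freq (ha : IsHormanderSymbol m ρ δ a) (hm : m + max 1 ρ < -n)
    (x z : 𝔼) :
    HasFDerivAt (oscInt (a x))
      (coordCLM fun j => oscInt (fun ξ => Complex.I * ((ξ j : ℂ) * a x ξ)) z) z :=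
  hasFDerivAt_oscInt
    (ha.integrable (by linarith [le_max_left 1 ρ]) x) (ha.integrable_norm_mul hm x) z

theorem hasFDerivAt_oscInt_space (ha : IsHormanderSymbol m ρ δ a) (hδ : 0 ≤ δ) (hm : m + δ < -n)
    (x z : 𝔼) :
    HasFDerivAt (fun x' => oscInt (a x') z)
      (coordCLM fun j => oscInt (_root_.spaceDeriv j a x) z) x := by
  choose C hC0 hC using fun j => (ha.spaceDeriv j).norm_le
  have h := hasFDerivAt_integral_coord (F := fun x ξ => a x ξ * planeWave z ξ)
    (G := fun j x ξ => _root_.spaceDeriv j a x ξ * planeWave z ξ)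
    (bound := fun ξ => (∑ j, C j) * (1 + ‖ξ‖) ^ (m + δ))
    (fun x => (ha.integrable (by linarith) x).mul_planeWave z)
    (fun j x => ((ha.spaceDeriv j).jointlySmooth.right x).continuous.aestronglyMeasurable.mul
      (continuous_planeWave_right z).aestronglyMeasurable)
    (fun j x ξ => by
      rw [norm_mul, norm_planeWave, mul_one]
      refine (hC j x ξ).trans (mul_le_mul_of_nonneg_right ?_ (by positivity))
      exact Finset.single_le_sum (fun j _ => hC0 j) (Finset.mem_univ j))
    ((integrable_one_add_norm_rpow hm).const_mul _)
    (fun ξ x => by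
      refine ((((ha.jointlySmooth.left ξ).differentiable (by simp) x).hasFDerivAt).mul_const
        (planeWave z ξ)).coordCLM fun j => ?_
      simp [_root_.spaceDeriv, coordDeriv, mul_comm]) x
  have h' : HasFDerivAt (fun x' => oscInt (a x') z) _ x :=
    h.const_mul ((((2 * π) ^ n)⁻¹ : ℝ) : ℂ)
  refine h'.coordCLM fun j => ?_
  rw [smul_apply, coordCLM_single, smul_eq_mul]
  rfl

theorem continuous_oscInt (ha : IsHormanderSymbol m ρ δ a) (hm : m < -n) :
    Continuous (fun p : 𝔼 × 𝔼 => oscInt (a p.1) p.2) := by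
  obtain ⟨C, -, hC⟩ := ha.norm_le
  refine continuous_const.mul (continuous_of_dominated
    (bound := fun ξ => C * (1 + ‖ξ‖) ^ m)
    (fun p => ((ha.integrable hm p.1).mul_planeWave p.2).aestronglyMeasurable)
    (fun p => Filter.Eventually.of_forall fun ξ => ?_)
    ((integrable_one_add_norm_rpow hm).const_mul C)
    (Filter.Eventually.of_forall fun ξ => ?_))
  · rw [norm_mul, norm_planeWave, mul_one]
    exact hC _ _
  · exact ((ha.jointlySmooth.left ξ).continuous.comp continuous_fst).mul
      (continuous_planeWave.comp (by fun_prop : Continuous fun p : 𝔼 × 𝔼 => (p.2, ξ)))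

theorem norm_oscInt_le (ha : IsHormanderSymbol m ρ δ a) (hm : m < -n) :
    ∃ C : ℝ, 0 ≤ C ∧ ∀ x z, ‖oscInt (a x) z‖ ≤ C := by
  obtain ⟨C, hC0, hC⟩ := ha.norm_le
  refine ⟨((2 * π) ^ n)⁻¹ * ∫ ξ : 𝔼, C * (1 + ‖ξ‖) ^ m,
    mul_nonneg (by positivity) (integral_nonneg fun ξ => by positivity), fun x z => ?_⟩
  refine (_root_.norm_oscInt_le _ z).trans (mul_le_mul_of_nonneg_left ?_ (by positivity))
  exact integral_mono (ha.integrable hm x).norm ((integrable_one_add_norm_rpow hm).const_mul C)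
    (hC x)

end IsHormanderSymbol

end OscillatoryIntegral

/-! ### The kernel off the origin by repeated integration by parts. -/

section RegularizedKernel

variable {n : ℕ} {m ρ δ : ℝ}

local notation "𝔼" => EuclideanSpace ℝ (Fin n)

/-- The weights `i z_j / |z|²`, for which `∑_j (i z_j / |z|²) ∂_{ξ_j}` is the transpose of a
first-order operator fixing the plane wave `e^{i z·ξ}`. -/
noncomputable def radialWeight (j : Fin n) (z : 𝔼) : ℂ :=
  Complex.I * ((z j * (‖z‖ ^ 2)⁻¹ : ℝ) : ℂ)

/-- The integral `(2π)^{-n} ∫ g(ξ) e^{i z·ξ} dξ` after `M` integrations by parts. -/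
noncomputable def regOsc : ℕ → (𝔼 → ℂ) → 𝔼 → ℂ
  | 0, g, z => oscInt g z
  | M + 1, g, z => ∑ j, radialWeight j z * regOsc M (coordDeriv j g) z

/-- The function `(2π)^{-n} ∫ g(ξ) e^{i z·ξ} dξ`, as an oscillatory integral if `z ≠ 0`. -/
noncomputable def oscKernel (g : 𝔼 → ℂ) (z : 𝔼) : ℂ :=
  open Classical in
  if z = 0 then oscInt g z else Filter.limUnder Filter.atTop fun M => regOsc M g z

theorem contDiffOn_radialWeight (j : Fin n) {r : ℕ∞ω} :
    ContDiffOn ℝ r (radialWeight j : 𝔼 → ℂ) {z | z ≠ 0} := by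
  unfold radialWeight
  refine contDiffOn_const.mul (Complex.ofRealCLM.contDiff.comp_contDiffOn ?_)
  refine ContDiffOn.mul (EuclideanSpace.proj j : 𝔼 →L[ℝ] ℝ).contDiff.contDiffOn
    (ContDiffOn.inv (contDiff_norm_sq ℝ).contDiffOn fun z hz => ?_)
  exact pow_ne_zero 2 (norm_ne_zero_iff.2 hz)

theorem norm_radialWeight_le (j : Fin n) (z : 𝔼) : ‖radialWeight j z‖ ≤ ‖z‖⁻¹ := by
  rw [radialWeight, norm_mul, Complex.norm_I, one_mul, Complex.norm_real, norm_mul, norm_inv,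
    norm_pow, norm_norm]
  rcases eq_or_ne z 0 with rfl | hz
  · simp
  have hz' : 0 < ‖z‖ := norm_pos_iff.2 hz
  calc ‖z j‖ * (‖z‖ ^ 2)⁻¹ ≤ ‖z‖ * (‖z‖ ^ 2)⁻¹ :=
        mul_le_mul_of_nonneg_right (PiLp.norm_apply_le z j) (by positivity)
    _ = ‖z‖⁻¹ := by field_simp

theorem sum_radialWeight_mul {z : 𝔼} (hz : z ≠ 0) :
    ∑ j, radialWeight j z * (-Complex.I * (z j : ℂ)) = 1 := by
  have h : ∀ j, radialWeight j z * (-Complex.I * (z j : ℂ)) =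
      ((z j ^ 2 * (‖z‖ ^ 2)⁻¹ : ℝ) : ℂ) := fun j => by
    rw [radialWeight]
    push_cast
    linear_combination (-(z j : ℂ) ^ 2 * ((‖z‖ : ℂ) ^ 2)⁻¹) * Complex.I_sq
  simp only [h]
  rw [← Complex.ofReal_sum, ← Finset.sum_mul]
  have : ∑ j, z j ^ 2 = ‖z‖ ^ 2 := by
    rw [EuclideanSpace.norm_sq_eq]
    simp
  rw [this, mul_inv_cancel₀ (pow_ne_zero 2 (norm_ne_zero_iff.2 hz)), Complex.ofReal_one]

theorem IsHormanderSymbol.mono {a : 𝔼 → 𝔼 → ℂ} {m' : ℝ} (ha : IsHormanderSymbol m ρ δ a)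
    (h : m ≤ m') : IsHormanderSymbol m' ρ δ a :=
  ⟨ha.smooth, fun α β => IsHormanderSymbol.exists_bound_of_le (by linarith) (ha.bound α β)⟩

theorem exists_sub_mul_lt (hρ : 0 < ρ) (m c : ℝ) : ∃ M : ℕ, m - ρ * M < c := by
  obtain ⟨M, hM⟩ := exists_nat_gt ((m - c) / ρ)
  refine ⟨M, ?_⟩
  rw [div_lt_iff₀ hρ] at hM
  linarith

section Fixed

variable {a b : EuclideanSpace ℝ (Fin n) → EuclideanSpace ℝ (Fin n) → ℂ}

/-- The weights depend on z alone and the ξ-derivatives commute, so the identity reduces to one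
integration by parts in an absolutely convergent integral. -/
theorem coord_mul_regOsc (hρ : 0 < ρ) (x z : 𝔼) (j : Fin n) {M : ℕ} :
    ∀ {m : ℝ} {a : 𝔼 → 𝔼 → ℂ}, IsHormanderSymbol m ρ δ a → m - ρ * M < -n →
      (z j : ℂ) * regOsc M (a x) z = Complex.I * regOsc M (freqDeriv j a x) z := by
  induction M with
  | zero =>
    intro m a ha hm
    rw [Nat.cast_zero, mul_zero, sub_zero] at hm
    exact coord_mul_oscInt ((ha.jointlySmooth.right x).differentiable (by simp))
      (ha.integrable hm x) j ((ha.freqDeriv j).integrable (by linarith) x) z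
  | succ M ih =>
    intro m a ha hm
    simp only [regOsc, Finset.mul_sum]
    refine Finset.sum_congr rfl fun i _ => ?_
    have h := ih (ha.freqDeriv i) (by push_cast at hm; linarith)
    rw [mul_left_comm, mul_left_comm Complex.I]
    congr 1
    rw [show coordDeriv i (a x) = freqDeriv i a x from rfl, h, freqDeriv_comm ha.jointlySmooth]
    rfl

/-- Past the threshold of absolute convergence, a further integration by parts only inserts ∑ w_j
(-i z_j) = 1. -/
theorem regOsc_succ (hρ : 0 < ρ) (ha : IsHormanderSymbol m ρ δ a) {M : ℕ}
    (hm : m - ρ * M < -n) (x : 𝔼) {z : 𝔼} (hz : z ≠ 0) :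
    regOsc (M + 1) (a x) z = regOsc M (a x) z := by
  have h : ∀ j, regOsc M (coordDeriv j (a x)) z = -Complex.I * (z j : ℂ) * regOsc M (a x) z :=
    fun j => by
      rw [mul_assoc, coord_mul_regOsc hρ x z j ha hm, ← mul_assoc, neg_mul, Complex.I_mul_I,
        neg_neg, one_mul]
      rfl
  simp only [regOsc, h, ← mul_assoc]
  rw [← Finset.sum_mul]
  simp only [mul_assoc (radialWeight _ _), sum_radialWeight_mul hz, one_mul]

/-- The sequence defining the limit is constant from M on; earlier terms, whose integrals may
diverge, play no role. -/
theorem oscKernel_eq_regOsc (hρ : 0 < ρ) (ha : IsHormanderSymbol m ρ δ a) {M : ℕ}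
    (hm : m - ρ * M < -n) (x : 𝔼) {z : 𝔼} (hz : z ≠ 0) :
    oscKernel (a x) z = regOsc M (a x) z := by
  rw [oscKernel, if_neg hz]
  refine Filter.Tendsto.limUnder_eq (tendsto_atTop_of_eventually_const (i₀ := M)
    fun M' (hM' : M ≤ M') => ?_)
  induction M', hM' using Nat.le_induction with
  | base => rfl
  | succ M' hM' ih =>
    rw [regOsc_succ hρ ha _ x hz, ih]
    have : ρ * (M : ℝ) ≤ ρ * (M' : ℝ) :=
      mul_le_mul_of_nonneg_left (Nat.cast_le.2 hM') hρ.le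
    linarith

theorem oscKernel_eq_oscInt (hρ : 0 < ρ) (ha : IsHormanderSymbol m ρ δ a) (hm : m < -n)
    (x z : 𝔼) : oscKernel (a x) z = oscInt (a x) z := by
  by_cases hz : z = 0
  · rw [oscKernel, if_pos hz]
  · rw [oscKernel_eq_regOsc hρ ha (M := 0) (by simpa using hm) x hz, regOsc]

theorem coord_mul_oscKernel (hρ : 0 < ρ) (ha : IsHormanderSymbol m ρ δ a) (x : 𝔼) {z : 𝔼}
    (hz : z ≠ 0) (j : Fin n) :
    (z j : ℂ) * oscKernel (a x) z = Complex.I * oscKernel (freqDeriv j a x) z := by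
  obtain ⟨M, hM⟩ := exists_sub_mul_lt hρ m (-n)
  rw [oscKernel_eq_regOsc hρ ha hM x hz,
    oscKernel_eq_regOsc hρ (ha.freqDeriv j) (M := M) (by linarith) x hz,
    coord_mul_regOsc hρ x z j ha hM]

/-- The engine of the later inductions: a kernel is expressed through kernels of order lower by ρ,
with weights of size at most |z|^{-1}. -/
theorem oscKernel_eq_sum (hρ : 0 < ρ) (ha : IsHormanderSymbol m ρ δ a) (x : 𝔼) {z : 𝔼}
    (hz : z ≠ 0) :
    oscKernel (a x) z = ∑ j, radialWeight j z * oscKernel (freqDeriv j a x) z := by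
  obtain ⟨M, hM⟩ := exists_sub_mul_lt hρ m (-n)
  rw [oscKernel_eq_regOsc hρ ha (M := M + 1) (by push_cast; linarith) x hz, regOsc]
  refine Finset.sum_congr rfl fun j _ => ?_
  rw [oscKernel_eq_regOsc hρ (ha.freqDeriv j) (M := M) (by linarith) x hz]
  rfl

theorem regOsc_add (x z : 𝔼) {M : ℕ} :
    ∀ {m : ℝ} {a b : 𝔼 → 𝔼 → ℂ}, IsHormanderSymbol m ρ δ a → IsHormanderSymbol m ρ δ b →
      m - ρ * M < -n → regOsc M ((a + b) x) z = regOsc M (a x) z + regOsc M (b x) z := by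
  induction M with
  | zero =>
    intro m a b ha hb hm
    rw [Nat.cast_zero, mul_zero, sub_zero] at hm
    exact oscInt_add (ha.integrable hm x) (hb.integrable hm x) z
  | succ M ih =>
    intro m a b ha hb hm
    simp only [regOsc, ← Finset.sum_add_distrib, ← mul_add]
    refine Finset.sum_congr rfl fun i _ => ?_
    have h := ih (ha.freqDeriv i) (hb.freqDeriv i) (by push_cast at hm; linarith)
    rw [Pi.add_apply, coordDeriv_add (ha.jointlySmooth.right x) (hb.jointlySmooth.right x)]
    exact congrArg _ h

theorem regOsc_const_mul (x z : 𝔼) {M : ℕ} :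
    ∀ {a : 𝔼 → 𝔼 → ℂ}, JointlySmooth a → ∀ c : ℂ,
      regOsc M (fun ξ => c * a x ξ) z = c * regOsc M (a x) z := by
  induction M with
  | zero => exact fun _ c => oscInt_const_mul c _ z
  | succ M ih =>
    intro a ha c
    simp only [regOsc, Finset.mul_sum]
    refine Finset.sum_congr rfl fun i _ => ?_
    rw [coordDeriv_const_mul (ha.right x), mul_left_comm]
    exact congrArg _ (ih (ha.freqDeriv i) c)

theorem oscKernel_add (hρ : 0 < ρ) (ha : IsHormanderSymbol m ρ δ a)
    (hb : IsHormanderSymbol m ρ δ b) (hab : IsHormanderSymbol m ρ δ (a + b)) (x : 𝔼) {z : 𝔼}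
    (hz : z ≠ 0) :
    oscKernel ((a + b) x) z = oscKernel (a x) z + oscKernel (b x) z := by
  obtain ⟨M, hM⟩ := exists_sub_mul_lt hρ m (-n)
  rw [oscKernel_eq_regOsc hρ ha hM x hz, oscKernel_eq_regOsc hρ hb hM x hz,
    oscKernel_eq_regOsc hρ hab hM x hz, regOsc_add x z ha hb hM]

theorem oscKernel_const_mul (hρ : 0 < ρ) (ha : IsHormanderSymbol m ρ δ a) (c : ℂ) (x : 𝔼) {z : 𝔼}
    (hz : z ≠ 0) : oscKernel (fun ξ => c * a x ξ) z = c * oscKernel (a x) z := by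
  obtain ⟨M, hM⟩ := exists_sub_mul_lt hρ m (-n)
  rw [oscKernel_eq_regOsc hρ ha hM x hz,
    show oscKernel (fun ξ => c * a x ξ) z = _ from
      oscKernel_eq_regOsc hρ (ha.const_mul c) hM x hz]
  exact regOsc_const_mul x z ha.jointlySmooth c

theorem oscKernel_freqDeriv_coord_mul (hρ : 0 < ρ) (ha : IsHormanderSymbol m ρ δ a) (x : 𝔼)
    {z : 𝔼} (hz : z ≠ 0) (i j : Fin n) :
    oscKernel (freqDeriv i (fun x ξ => (ξ j : ℂ) * a x ξ) x) z =
      oscKernel (fun ξ => (ξ j : ℂ) * freqDeriv i a x ξ) z +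
        (if i = j then 1 else 0) * oscKernel (a x) z := by
  have h1 := ((ha.freqDeriv i).coord_mul j)
  have h2 := (ha.const_mul (if i = j then 1 else 0)).mono
    (m' := m - ρ + max 1 ρ) (by linarith [le_max_right 1 ρ])
  have h3 := ((ha.coord_mul j).freqDeriv i).mono (m' := m - ρ + max 1 ρ) (by linarith)
  rw [freqDeriv_coord_mul ha.jointlySmooth] at h3 ⊢
  rw [oscKernel_add hρ h1 h2 h3 x hz]
  congr 1
  exact oscKernel_const_mul hρ ha _ x hz

/-- Induction on the number of steps of size ρ needed to make the differentiated integrand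
integrable. -/
theorem hasFDerivAt_oscKernel_freq (hρ : 0 < ρ) (x : 𝔼) {z : 𝔼} (hz : z ≠ 0)
    (ha : IsHormanderSymbol m ρ δ a) :
    HasFDerivAt (oscKernel (a x))
      (coordCLM fun j => oscKernel (fun ξ => Complex.I * ((ξ j : ℂ) * a x ξ)) z) z := by
  suffices H : ∀ (M : ℕ) (m : ℝ) (a : 𝔼 → 𝔼 → ℂ), IsHormanderSymbol m ρ δ a →
      m + max 1 ρ - ρ * M < -n → HasFDerivAt (oscKernel (a x))
        (coordCLM fun j => oscKernel (fun ξ => Complex.I * ((ξ j : ℂ) * a x ξ)) z) z by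
    obtain ⟨M, hM⟩ := exists_sub_mul_lt hρ (m + max 1 ρ) (-n)
    exact H M m a ha hM
  intro M
  induction M with
  | zero =>
    intro m a ha hm
    rw [Nat.cast_zero, mul_zero, sub_zero] at hm
    rw [funext (oscKernel_eq_oscInt hρ ha (by linarith [le_max_left 1 ρ]) x)]
    convert ha.hasFDerivAt_oscInt_freq hm x z using 3 with j
    exact oscKernel_eq_oscInt hρ ((ha.coord_mul j).const_mul Complex.I) hm x z
  | succ M ih =>
    intro m a ha hm
    have hnhds : {z : 𝔼 | z ≠ 0} ∈ nhds z := isOpen_ne.mem_nhds hz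
    -- The expansion over ∂_{ξ_j} a yields differentiability only; differentiating it would bring in
    -- derivatives of the weights.
    have hd : DifferentiableAt ℝ (oscKernel (a x)) z := by
      have h : DifferentiableAt ℝ
          (fun z => ∑ j, radialWeight j z * oscKernel (freqDeriv j a x) z) z := by
        refine DifferentiableAt.fun_sum fun j _ => ?_
        refine (((contDiffOn_radialWeight j (r := 1)).contDiffAt hnhds).differentiableAt
          (by simp)).mul ?_
        exact (ih (m - ρ) _ (ha.freqDeriv j) (by push_cast at hm; linarith)).differentiableAt
      refine h.congr_of_eventuallyEq ?_
      filter_upwards [hnhds] with z' hz'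
      exact oscKernel_eq_sum hρ ha x hz'
    refine hd.hasFDerivAt.coordCLM fun j => ?_
    -- The derivative is found by differentiating z_i K(a) = i K(∂_i a) and cancelling a nonzero
    -- z_i. The product rule's δ_{ij} K(a) matches the commutator of ∂_i with ξ_j.
    obtain ⟨i, hi⟩ : ∃ i, z i ≠ 0 := by
      by_contra! h0
      exact hz (by ext i; simpa using h0 i)
    have hi' : (z i : ℂ) ≠ 0 := by simpa using hi
    have hL : HasFDerivAt (fun z : 𝔼 => (z i : ℂ) * oscKernel (a x) z) _ z :=
      (Complex.ofRealCLM ∘L (EuclideanSpace.proj i : 𝔼 →L[ℝ] ℝ)).hasFDerivAt.mul hd.hasFDerivAt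
    have hR : HasFDerivAt (fun z : 𝔼 => Complex.I * oscKernel (freqDeriv i a x) z) _ z :=
      (ih (m - ρ) _ (ha.freqDeriv i) (by push_cast at hm; linarith)).const_mul Complex.I
    have hLR := hL.unique (hR.congr_of_eventuallyEq (by
      filter_upwards [hnhds] with z' hz'
      exact coord_mul_oscKernel hρ ha x hz' i))
    have h1 := congrArg (fun L : 𝔼 →L[ℝ] ℂ => L (EuclideanSpace.single j 1)) hLR
    have h2 : oscKernel (fun ξ => Complex.I * ((ξ j : ℂ) * a x ξ)) z =
        Complex.I * oscKernel (fun ξ => (ξ j : ℂ) * a x ξ) z :=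
      oscKernel_const_mul hρ (ha.coord_mul j) Complex.I x hz
    have h3 : oscKernel (fun ξ => Complex.I * ((ξ j : ℂ) * freqDeriv i a x ξ)) z =
        Complex.I * oscKernel (fun ξ => (ξ j : ℂ) * freqDeriv i a x ξ) z :=
      oscKernel_const_mul hρ ((ha.freqDeriv i).coord_mul j) Complex.I x hz
    have h4 := coord_mul_oscKernel hρ (ha.coord_mul j) x hz i
    have h5 := oscKernel_freqDeriv_coord_mul hρ ha x hz i j
    have h6 : (((EuclideanSpace.single j (1 : ℝ) : 𝔼) i : ℝ) : ℂ) = if i = j then 1 else 0 := by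
      by_cases hij : i = j <;> simp [hij]
    simp only [add_apply, smul_apply, smul_eq_mul, coordCLM_single, ContinuousLinearMap.comp_apply,
      PiLp.proj_apply, Complex.ofRealCLM_apply, h6, h3] at h1
    refine mul_left_cancel₀ hi' ?_
    rw [h2]
    rw [h5] at h4
    linear_combination h1 - Complex.I * h4 - (if i = j then 1 else 0) * oscKernel (a x) z *
      Complex.I_sq

theorem hasFDerivAt_regOsc_space (hδ : 0 ≤ δ) (x z : 𝔼) {M : ℕ} :
    ∀ {m : ℝ} {a : 𝔼 → 𝔼 → ℂ}, IsHormanderSymbol m ρ δ a → m + δ - ρ * M < -n →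
      HasFDerivAt (fun x' => regOsc M (a x') z)
        (coordCLM fun j => regOsc M (spaceDeriv j a x) z) x := by
  induction M with
  | zero =>
    intro m a ha hm
    exact ha.hasFDerivAt_oscInt_space hδ (by simpa using hm) x z
  | succ M ih =>
    intro m a ha hm
    have h : HasFDerivAt (fun x' => ∑ i, radialWeight i z * regOsc M (freqDeriv i a x') z) _ x :=
      HasFDerivAt.fun_sum fun i _ => (ih (ha.freqDeriv i)
        (by push_cast at hm; linarith)).const_mul (radialWeight i z)
    refine HasFDerivAt.coordCLM h fun j => ?_
    simp only [sum_apply, smul_apply, coordCLM_single, smul_eq_mul, regOsc]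
    refine Finset.sum_congr rfl fun i _ => ?_
    rw [spaceDeriv_freqDeriv ha.jointlySmooth]
    rfl

theorem hasFDerivAt_oscKernel_space (hρ : 0 < ρ) (hδ : 0 ≤ δ) (ha : IsHormanderSymbol m ρ δ a)
    (x : 𝔼) {z : 𝔼} (hz : z ≠ 0 ∨ m + δ < -n) :
    HasFDerivAt (fun x' => oscKernel (a x') z)
      (coordCLM fun j => oscKernel (spaceDeriv j a x) z) x := by
  rcases hz with hz | hm
  · obtain ⟨M, hM⟩ := exists_sub_mul_lt hρ (m + δ) (-n)
    rw [funext fun x' => oscKernel_eq_regOsc hρ ha (M := M) (by linarith) x' hz]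
    simp only [fun j => oscKernel_eq_regOsc hρ (ha.spaceDeriv j) hM x hz]
    exact hasFDerivAt_regOsc_space hδ x z ha hM
  · rw [funext fun x' => oscKernel_eq_oscInt hρ ha (by linarith) x' z]
    simp only [fun j => oscKernel_eq_oscInt hρ (ha.spaceDeriv j) hm x z]
    exact ha.hasFDerivAt_oscInt_space hδ hm x z

theorem continuousOn_regOsc {M : ℕ} :
    ∀ {m : ℝ} {a : 𝔼 → 𝔼 → ℂ}, IsHormanderSymbol m ρ δ a → m - ρ * M < -n →
      ContinuousOn (fun p : 𝔼 × 𝔼 => regOsc M (a p.1) p.2) {p | p.2 ≠ 0} := by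
  induction M with
  | zero =>
    intro m a ha hm
    exact (ha.continuous_oscInt (by simpa using hm)).continuousOn
  | succ M ih =>
    intro m a ha hm
    refine continuousOn_finsetSum _ fun i _ => ContinuousOn.mul ?_
      (ih (ha.freqDeriv i) (by push_cast at hm; linarith))
    exact (contDiffOn_radialWeight i (r := 0)).continuousOn.comp continuousOn_snd fun p hp => hp

theorem continuousOn_oscKernel (hρ : 0 < ρ) (ha : IsHormanderSymbol m ρ δ a) :
    ContinuousOn (fun p : 𝔼 × 𝔼 => oscKernel (a p.1) p.2) {p | p.2 ≠ 0} := by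
  obtain ⟨M, hM⟩ := exists_sub_mul_lt hρ m (-n)
  exact (continuousOn_regOsc ha hM).congr fun p hp => oscKernel_eq_regOsc hρ ha hM p.1 hp

theorem hasFDerivAt_oscKernel (hρ : 0 < ρ) (hδ : 0 ≤ δ) (ha : IsHormanderSymbol m ρ δ a)
    {p : 𝔼 × 𝔼} (hp : p.2 ≠ 0) :
    HasFDerivAt (fun p : 𝔼 × 𝔼 => oscKernel (a p.1) p.2)
      ((coordCLM fun j => oscKernel (spaceDeriv j a p.1) p.2).coprod
        (coordCLM fun j => oscKernel (fun ξ => Complex.I * ((ξ j : ℂ) * a p.1 ξ)) p.2)) p := by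
  have hnhds : {p : 𝔼 × 𝔼 | p.2 ≠ 0} ∈ nhds p :=
    (isOpen_ne.preimage continuous_snd).mem_nhds hp
  refine (hasStrictFDerivAt_uncurry_coprod (f := fun x z => oscKernel (a x) z)
    (f₁ := fun x z => coordCLM fun j => oscKernel (spaceDeriv j a x) z)
    (f₂ := fun x z => coordCLM fun j => oscKernel (fun ξ => Complex.I * ((ξ j : ℂ) * a x ξ)) z)
    ?_ ?_ ?_ ?_).hasFDerivAt
  · filter_upwards [hnhds] with v hv
    exact hasFDerivAt_oscKernel_space hρ hδ ha v.1 (Or.inl hv)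
  · filter_upwards [hnhds] with v hv
    exact hasFDerivAt_oscKernel_freq hρ v.1 hv ha
  · refine (contDiff_coordCLM (r := 0)).continuous.continuousAt.comp (continuousAt_pi.2 fun j => ?_)
    exact (continuousOn_oscKernel hρ (ha.spaceDeriv j)).continuousAt hnhds
  · refine (contDiff_coordCLM (r := 0)).continuous.continuousAt.comp (continuousAt_pi.2 fun j => ?_)
    exact (continuousOn_oscKernel hρ ((ha.coord_mul j).const_mul Complex.I)).continuousAt hnhds

/-- Both partial derivatives are kernels of symbols, of other orders, so the induction on the degree
of smoothness runs over all symbols at once. -/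
theorem contDiffOn_oscKernel (hρ : 0 < ρ) (hδ : 0 ≤ δ) (ha : IsHormanderSymbol m ρ δ a) :
    ContDiffOn ℝ ∞ (fun p : 𝔼 × 𝔼 => oscKernel (a p.1) p.2) {p | p.2 ≠ 0} := by
  have hopen : IsOpen {p : 𝔼 × 𝔼 | p.2 ≠ 0} := isOpen_ne.preimage continuous_snd
  refine contDiffOn_infty.2 fun r => ?_
  induction r generalizing m a with
  | zero => exact contDiffOn_zero.2 (continuousOn_oscKernel hρ ha)
  | succ r ih =>
    push_cast
    refine (contDiffOn_succ_iff_hasFDerivWithinAt_of_uniqueDiffOn hopen.uniqueDiffOn).2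
      ⟨by simp, _, ?_, fun p hp => (hasFDerivAt_oscKernel hρ hδ ha hp).hasFDerivWithinAt⟩
    have h1 : ContDiffOn ℝ r (fun p : 𝔼 × 𝔼 =>
        coordCLM fun j => oscKernel (spaceDeriv j a p.1) p.2) {p | p.2 ≠ 0} :=
      contDiff_coordCLM.comp_contDiffOn (contDiffOn_pi.2 fun j => ih (ha.spaceDeriv j))
    have h2 : ContDiffOn ℝ r (fun p : 𝔼 × 𝔼 => coordCLM fun j =>
        oscKernel (fun ξ => Complex.I * ((ξ j : ℂ) * a p.1 ξ)) p.2) {p | p.2 ≠ 0} :=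
      contDiff_coordCLM.comp_contDiffOn
        (contDiffOn_pi.2 fun j => ih ((ha.coord_mul j).const_mul Complex.I))
    exact (h1.continuousLinearMap_comp
        ((ContinuousLinearMap.compL ℝ (𝔼 × 𝔼) 𝔼 ℂ).flip (ContinuousLinearMap.fst ℝ 𝔼 𝔼))).add
      (h2.continuousLinearMap_comp
        ((ContinuousLinearMap.compL ℝ (𝔼 × 𝔼) 𝔼 ℂ).flip (ContinuousLinearMap.snd ℝ 𝔼 𝔼)))

/-- M integrations by parts, each worth |z|^{-1}, end at an order below -n, where the integral is
bounded. The estimate serves both z → 0 and |z| → ∞. -/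
theorem norm_oscKernel_le (hρ : 0 < ρ) {M : ℕ} (ha : IsHormanderSymbol m ρ δ a)
    (hm : m - ρ * M < -n) :
    ∃ C : ℝ, 0 ≤ C ∧ ∀ x z : 𝔼, z ≠ 0 → ‖oscKernel (a x) z‖ ≤ C * (‖z‖ ^ M)⁻¹ := by
  induction M generalizing m a with
  | zero =>
    rw [Nat.cast_zero, mul_zero, sub_zero] at hm
    obtain ⟨C, hC0, hC⟩ := ha.norm_oscInt_le hm
    refine ⟨C, hC0, fun x z _ => ?_⟩
    simpa [oscKernel_eq_oscInt hρ ha hm x z] using hC x z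
  | succ M ih =>
    choose C hC0 hC using fun j => ih (ha.freqDeriv j) (by push_cast at hm; linarith)
    refine ⟨∑ j, C j, Finset.sum_nonneg fun j _ => hC0 j, fun x z hz => ?_⟩
    rw [oscKernel_eq_sum hρ ha x hz, Finset.sum_mul]
    refine (norm_sum_le _ _).trans (Finset.sum_le_sum fun j _ => ?_)
    rw [norm_mul]
    calc ‖radialWeight j z‖ * ‖oscKernel (freqDeriv j a x) z‖
        ≤ ‖z‖⁻¹ * (C j * (‖z‖ ^ M)⁻¹) :=
          mul_le_mul (norm_radialWeight_le j z) (hC j x z hz) (norm_nonneg _) (by positivity)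
      _ = C j * (‖z‖ ^ (M + 1))⁻¹ := by rw [pow_succ, mul_inv]; ring

end Fixed

end RegularizedKernel

/-! ### Pointwise bounds for kernels and their derivatives. -/

section KernelBounds

variable {n : ℕ} {m ρ δ : ℝ}

local notation "𝔼" => EuclideanSpace ℝ (Fin n)

theorem multiLength_eq_sum_map (β : Fin n → ℕ) :
    multiLength β = ((List.finRange n).map β).sum := by
  rw [multiLength, Fin.sum_univ_def]

/-- If the `i`-th operation raises the order of a symbol by `c`, then the `α`-th iterate of the
operations raises it by `c |α|`. -/
theorem exists_symbol_foldr_iterate {c : ℝ} {R : ℝ → (𝔼 → 𝔼 → ℂ) → Prop}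
    {D : Fin n → (𝔼 → 𝔼 → ℂ) → 𝔼 → 𝔼 → ℂ} (hD : ∀ i s F, R s F → R (s + c) (D i F))
    (α : Fin n → ℕ) {s : ℝ} {F : 𝔼 → 𝔼 → ℂ} (hF : R s F) :
    R (s + c * (multiLength α : ℝ)) ((List.finRange n).foldr (fun i g => (D i)^[α i] g) F) := by
  have iter : ∀ (i : Fin n) (k : ℕ) (s : ℝ) (F : 𝔼 → 𝔼 → ℂ), R s F →
      R (s + c * (k : ℝ)) ((D i)^[k] F) := by
    intro i k
    induction k with
    | zero => intro s F h; simpa using h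
    | succ k ih =>
      intro s F h
      rw [Function.iterate_succ_apply']
      convert hD i _ _ (ih s F h) using 1
      push_cast
      ring
  rw [multiLength_eq_sum_map]
  induction List.finRange n with
  | nil => simpa using hF
  | cons i l ih =>
    rw [List.foldr_cons]
    convert iter i (α i) _ _ ih using 1
    rw [List.map_cons, List.sum_cons]
    push_cast
    ring

theorem exists_symbol_multiDeriv_freq {a : 𝔼 → 𝔼 → ℂ} (hρ : 0 < ρ)
    (ha : IsHormanderSymbol m ρ δ a) (β : Fin n → ℕ) :
    ∃ b, IsHormanderSymbol (m + max 1 ρ * (multiLength β : ℝ)) ρ δ b ∧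
      ∀ x z : 𝔼, z ≠ 0 ∨ m + max 1 ρ * (multiLength β : ℝ) < -n →
        multiDeriv β (oscKernel (a x)) z = oscKernel (b x) z := by
  have hpos : 0 < max 1 ρ := lt_max_of_lt_left one_pos
  have h := exists_symbol_foldr_iterate (c := max 1 ρ)
    (R := fun s F => ∃ b, IsHormanderSymbol s ρ δ b ∧
      ∀ x z : 𝔼, z ≠ 0 ∨ s < -n → F x z = oscKernel (b x) z)
    (D := freqDeriv) ?_ β (s := m) (F := fun x => oscKernel (a x)) ⟨a, ha, fun _ _ _ => rfl⟩
  · simpa only [foldr_freqDeriv_apply] using h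
  rintro i s F ⟨b, hb, hF⟩
  refine ⟨_, (hb.coord_mul i).const_mul Complex.I, fun x z hz => ?_⟩
  rw [freqDeriv, coordDeriv]
  -- At z = 0 the derivative is meaningful only if the differentiated integral converges absolutely;
  -- then `F x` is the integral on the whole space, the previous order being lower still.
  by_cases hs : s + max 1 ρ < -n
  · have hFx : F x = oscInt (b x) := funext fun z => by
      rw [hF x z (Or.inr (by linarith)), oscKernel_eq_oscInt hρ hb (by linarith)]
    rw [hFx, (hb.hasFDerivAt_oscInt_freq hs x z).fderiv, coordCLM_single]
    exact (oscKernel_eq_oscInt hρ ((hb.coord_mul i).const_mul Complex.I) hs x z).symm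
  · have hz' : z ≠ 0 := hz.resolve_right hs
    have hFx : F x =ᶠ[nhds z] oscKernel (b x) := by
      filter_upwards [isOpen_ne.mem_nhds hz'] with z' h using hF x z' (Or.inl h)
    rw [hFx.fderiv_eq, (hasFDerivAt_oscKernel_freq hρ x hz' hb).fderiv, coordCLM_single]

theorem exists_symbol_multiDeriv_space {a : 𝔼 → 𝔼 → ℂ} (hρ : 0 < ρ) (hδ : 0 ≤ δ)
    (ha : IsHormanderSymbol m ρ δ a) (α : Fin n → ℕ) :
    ∃ b, IsHormanderSymbol (m + δ * (multiLength α : ℝ)) ρ δ b ∧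
      ∀ x z : 𝔼, z ≠ 0 → multiDeriv α (fun x' => oscKernel (a x') z) x = oscKernel (b x) z := by
  -- With the arguments exchanged, `freqDeriv` differentiates in x.
  have h := exists_symbol_foldr_iterate (c := δ)
    (R := fun s F => ∃ b, IsHormanderSymbol s ρ δ b ∧
      ∀ x z : 𝔼, z ≠ 0 → F z x = oscKernel (b x) z)
    (D := freqDeriv) ?_ α (s := m) (F := fun z x => oscKernel (a x) z) ⟨a, ha, fun _ _ _ => rfl⟩
  · simpa only [foldr_freqDeriv_apply] using h
  rintro i s F ⟨b, hb, hF⟩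
  refine ⟨_, hb.spaceDeriv i, fun x z hz => ?_⟩
  rw [freqDeriv, coordDeriv, show F z = fun x => oscKernel (b x) z from funext fun x => hF x z hz,
    (hasFDerivAt_oscKernel_space hρ hδ hb x (Or.inl hz)).fderiv, coordCLM_single]

theorem oscInt_translate (g : 𝔼 → ℂ) (z h : 𝔼) :
    planeWave z h * oscInt (fun ξ => g (ξ + h)) z = oscInt g z := by
  have := integral_add_right_eq_self (μ := volume) (fun ξ => g ξ * planeWave z ξ) h
  rw [oscInt, oscInt, ← this, mul_left_comm, ← integral_const_mul]
  congr 2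
  funext ξ
  rw [planeWave_add_right]
  ring

theorem rpow_le_of_comparable {u v : ℝ} (hu : 0 < u) (hv : 0 < v) (huv : u ≤ 2 * v)
    (hvu : v ≤ 2 * u) (s : ℝ) : v ^ s ≤ 2 ^ |s| * u ^ s := by
  rcases le_total 0 s with hs | hs
  · rw [abs_of_nonneg hs, ← Real.mul_rpow (by norm_num) hu.le]
    exact Real.rpow_le_rpow hv.le hvu hs
  · have h : u ^ (-s) ≤ 2 ^ (-s) * v ^ (-s) := by
      rw [← Real.mul_rpow (by norm_num) hv.le]
      exact Real.rpow_le_rpow hu.le huv (by linarith)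
    rw [Real.rpow_neg hu.le, Real.rpow_neg hv.le] at h
    rw [abs_of_nonpos hs]
    have hus : 0 < u ^ s := Real.rpow_pos_of_pos hu s
    have hvs : 0 < v ^ s := Real.rpow_pos_of_pos hv s
    rw [inv_le_iff_one_le_mul₀ hus] at h
    calc v ^ s = v ^ s * 1 := (mul_one _).symm
      _ ≤ v ^ s * (2 ^ (-s) * (v ^ s)⁻¹ * u ^ s) := mul_le_mul_of_nonneg_left h hvs.le
      _ = 2 ^ (-s) * u ^ s := by field_simp

theorem IsHormanderSymbol.norm_fderiv_le {a : 𝔼 → 𝔼 → ℂ} (ha : IsHormanderSymbol m ρ δ a) :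
    ∃ C : ℝ, 0 ≤ C ∧ ∀ x ξ, ‖fderiv ℝ (a x) ξ‖ ≤ C * (1 + ‖ξ‖) ^ (m - ρ) := by
  choose C hC0 hC using fun j => (ha.freqDeriv j).norm_le
  refine ⟨∑ j, C j, Finset.sum_nonneg fun j _ => hC0 j, fun x ξ => ?_⟩
  rw [eq_coordCLM (fderiv ℝ (a x) ξ), Finset.sum_mul]
  exact (norm_coordCLM_le _).trans (Finset.sum_le_sum fun j _ => hC j x ξ)

/-- Increments of a symbol over long distances, interpolated between the bounds of order zero
and one. -/
theorem IsHormanderSymbol.norm_translate_sub_le {a : 𝔼 → 𝔼 → ℂ} (ha : IsHormanderSymbol m ρ δ a)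
    (hρ1 : ρ ≤ 1) {N : ℝ} (hN0 : 0 ≤ N) (hN1 : N ≤ 1) :
    ∃ C : ℝ, 0 ≤ C ∧ ∀ x ξ h : 𝔼, 1 ≤ ‖h‖ → ‖a x (ξ + h) - a x ξ‖ ≤
      C * ‖h‖ ^ N * ((1 + ‖ξ‖) ^ (m - N * ρ) + (1 + ‖ξ + h‖) ^ (m - N * ρ)) := by
  obtain ⟨C, hC0, hC⟩ := ha.norm_le
  obtain ⟨C', hC'0, hC'⟩ := ha.norm_fderiv_le
  -- One constant dominating those of both bounds, so that D^{1-N} D^N = D after interpolation.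
  set D : ℝ := C + C * 2 ^ |m| + C' * 2 ^ |m - ρ| with hD
  have hD0 : 0 ≤ D := by positivity
  refine ⟨4 * C + D, by positivity, fun x ξ h hh => ?_⟩
  have hξ0 : (0 : ℝ) < 1 + ‖ξ‖ := by positivity
  have hξh0 : (0 : ℝ) < 1 + ‖ξ + h‖ := by positivity
  have hhN : (0 : ℝ) ≤ ‖h‖ ^ N := by positivity
  -- For |ξ| ≤ 2|h| both endpoints have 1 + |η| ≤ 4|h|, and since ρ ≤ 1 the factor |h|^N pays for (1
  -- + |η|)^{Nρ}. For |ξ| > 2|h| the whole segment is comparable to ξ and the mean value bound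
  -- applies.
  rcases le_or_gt ‖ξ‖ (2 * ‖h‖) with hle | hgt
  · have key : ∀ η : 𝔼, ‖η‖ ≤ 3 * ‖h‖ →
        ‖a x η‖ ≤ 4 * C * ‖h‖ ^ N * (1 + ‖η‖) ^ (m - N * ρ) := fun η hη => by
      have hη0 : (0 : ℝ) < 1 + ‖η‖ := by positivity
      have h1 : (1 + ‖η‖) ^ (N * ρ) ≤ 4 * ‖h‖ ^ N := by
        calc (1 + ‖η‖) ^ (N * ρ) ≤ (1 + ‖η‖) ^ N :=
              Real.rpow_le_rpow_of_exponent_le (by linarith [norm_nonneg η])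
                (mul_le_of_le_one_right hN0 hρ1)
          _ ≤ (4 * ‖h‖) ^ N := Real.rpow_le_rpow hη0.le (by linarith) hN0
          _ = 4 ^ N * ‖h‖ ^ N := Real.mul_rpow (by norm_num) (norm_nonneg h)
          _ ≤ 4 * ‖h‖ ^ N := mul_le_mul_of_nonneg_right
              (Real.rpow_le_self_of_one_le (by norm_num) hN1) hhN
      calc ‖a x η‖ ≤ C * (1 + ‖η‖) ^ m := hC x η
        _ = C * ((1 + ‖η‖) ^ (N * ρ) * (1 + ‖η‖) ^ (m - N * ρ)) := by
            rw [← Real.rpow_add hη0]; ring_nf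
        _ ≤ C * (4 * ‖h‖ ^ N * (1 + ‖η‖) ^ (m - N * ρ)) := by gcongr
        _ = _ := by ring
    have h1 := key ξ (by linarith)
    have h2 := key (ξ + h) ((norm_add_le _ _).trans (by linarith))
    calc ‖a x (ξ + h) - a x ξ‖ ≤ ‖a x (ξ + h)‖ + ‖a x ξ‖ := norm_sub_le _ _
      _ ≤ 4 * C * ‖h‖ ^ N * ((1 + ‖ξ‖) ^ (m - N * ρ) + (1 + ‖ξ + h‖) ^ (m - N * ρ)) := by linarith
      _ ≤ _ := by gcongr; linarith
  · have comp : ∀ η ∈ segment ℝ ξ (ξ + h), ∀ s : ℝ,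
        (1 + ‖η‖) ^ s ≤ 2 ^ |s| * (1 + ‖ξ‖) ^ s := fun η hη s => by
      have hd : ‖η - ξ‖ ≤ ‖h‖ := by
        obtain ⟨t, ht, rfl⟩ := (segment_eq_image' ℝ ξ (ξ + h)).subset hη
        rw [add_sub_cancel_left, add_sub_cancel_left, norm_smul, Real.norm_of_nonneg ht.1]
        exact mul_le_of_le_one_left (norm_nonneg h) ht.2
      have h1 : ‖η‖ ≤ ‖ξ‖ + ‖η - ξ‖ := norm_le_norm_add_norm_sub' η ξ
      have h2 : ‖ξ‖ ≤ ‖η‖ + ‖η - ξ‖ := norm_le_norm_add_norm_sub η ξ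
      exact rpow_le_of_comparable hξ0 (by positivity) (by linarith) (by linarith) s
    have hP : ‖a x (ξ + h) - a x ξ‖ ≤ D * (1 + ‖ξ‖) ^ m := by
      have h1 := (hC x (ξ + h)).trans
        (mul_le_mul_of_nonneg_left (comp _ (right_mem_segment ℝ _ _) m) hC0)
      have h2 : 0 ≤ C' * 2 ^ |m - ρ| * (1 + ‖ξ‖) ^ m := by positivity
      have h3 := norm_sub_le (a x (ξ + h)) (a x ξ)
      have h4 := hC x ξ
      rw [hD]
      linarith
    have hQ : ‖a x (ξ + h) - a x ξ‖ ≤ D * (‖h‖ * (1 + ‖ξ‖) ^ (m - ρ)) := by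
      have h1 := (convex_segment ξ (ξ + h)).norm_image_sub_le_of_norm_fderiv_le (𝕜 := ℝ) (f := a x)
        (C := C' * 2 ^ |m - ρ| * (1 + ‖ξ‖) ^ (m - ρ))
        (fun η _ => (ha.jointlySmooth.right x).differentiable (by simp) η)
        (fun η hη => ((hC' x η).trans
          (mul_le_mul_of_nonneg_left (comp η hη (m - ρ)) hC'0)).trans_eq (by ring))
        (left_mem_segment ℝ _ _) (right_mem_segment ℝ _ _)
      rw [add_sub_cancel_left] at h1
      refine h1.trans ?_
      have h2 : 0 ≤ (C + C * 2 ^ |m|) * (‖h‖ * (1 + ‖ξ‖) ^ (m - ρ)) := by positivity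
      rw [hD]
      linarith
    have hA : ‖a x (ξ + h) - a x ξ‖ ≤ D * ‖h‖ ^ N * (1 + ‖ξ‖) ^ (m - N * ρ) := by
      set A := ‖a x (ξ + h) - a x ξ‖ with hAdef
      have hA0 : 0 ≤ A := norm_nonneg _
      calc A = A ^ (1 - N) * A ^ N := by
            rw [← Real.rpow_add' hA0 (by norm_num), sub_add_cancel, Real.rpow_one]
        _ ≤ (D * (1 + ‖ξ‖) ^ m) ^ (1 - N) * (D * (‖h‖ * (1 + ‖ξ‖) ^ (m - ρ))) ^ N :=
            mul_le_mul (Real.rpow_le_rpow hA0 hP (by linarith)) (Real.rpow_le_rpow hA0 hQ hN0)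
              (by positivity) (by positivity)
        _ = (D ^ (1 - N) * D ^ N) * ‖h‖ ^ N *
              ((1 + ‖ξ‖) ^ (m * (1 - N)) * (1 + ‖ξ‖) ^ ((m - ρ) * N)) := by
            rw [Real.mul_rpow hD0 (by positivity), Real.mul_rpow hD0 (by positivity),
              Real.mul_rpow (norm_nonneg h) (by positivity), ← Real.rpow_mul hξ0.le,
              ← Real.rpow_mul hξ0.le]
            ring
        _ = D * ‖h‖ ^ N * (1 + ‖ξ‖) ^ (m - N * ρ) := by
            rw [← Real.rpow_add' hD0 (by norm_num), sub_add_cancel, Real.rpow_one,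
              ← Real.rpow_add hξ0]
            ring_nf
    refine hA.trans ?_
    have h1 : 0 ≤ (1 + ‖ξ + h‖) ^ (m - N * ρ) := by positivity
    have h2 : 0 ≤ (1 + ‖ξ‖) ^ (m - N * ρ) := by positivity
    gcongr
    · linarith
    · linarith

/-- A kernel is controlled by increments of the symbol over half a period of the plane wave. -/
theorem norm_oscKernel_le_integral_translate {a : 𝔼 → 𝔼 → ℂ} (hρ : 0 < ρ)
    (ha : IsHormanderSymbol m ρ δ a) (hm : m - ρ < -n) (x : 𝔼) {z h : 𝔼} (hz : z ≠ 0)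
    (hh : planeWave z h = -1) (hG : Integrable fun ξ => a x (ξ + h) - a x ξ) :
    ‖oscKernel (a x) z‖ ≤ ((2 * π) ^ n)⁻¹ * ∫ ξ, ‖a x (ξ + h) - a x ξ‖ := by
  set G : 𝔼 → ℂ := fun ξ => a x (ξ + h) - a x ξ with hGdef
  have hax := ha.jointlySmooth.right x
  have hd : Differentiable ℝ (a x) := hax.differentiable (by simp)
  have hdh : Differentiable ℝ fun ξ => a x (ξ + h) :=
    hd.comp (differentiable_id.add_const h)
  have hcG : ∀ j, coordDeriv j G =
      fun ξ => freqDeriv j a x (ξ + h) + (-1) * freqDeriv j a x ξ := fun j => by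
    funext ξ
    simp only [coordDeriv, hGdef]
    rw [fderiv_fun_sub (hdh ξ) (hd ξ), fderiv_comp_add_right]
    simp [freqDeriv, coordDeriv, sub_eq_add_neg]
  have hint : ∀ j, Integrable (freqDeriv j a x) := fun j => (ha.freqDeriv j).integrable hm x
  have hinth : ∀ j, Integrable fun ξ => freqDeriv j a x (ξ + h) := fun j =>
    (hint j).comp_add_right h
  -- The symbol itself need not be integrable, so the half-period shift is applied to ∂_j a, of
  -- order m - ρ < -n: it gives -2 times the integral of ∂_j a for that of ∂_j G. Integration by
  -- parts then trades ∂_j for z_j, and the weights reassemble the kernel.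
  have hosc : ∀ j, oscKernel (freqDeriv j a x) z =
      -(1 / 2) * (-Complex.I * (z j : ℂ)) * oscInt G z := fun j => by
    rw [oscKernel_eq_oscInt hρ (ha.freqDeriv j) hm]
    have h1 := coord_mul_oscInt (hdh.sub hd) hG j
      (by rw [show (fun ξ => a x (ξ + h)) - a x = G from rfl, hcG j]; exact (hinth j).add ((hint j).const_mul _)) z
    have h2 := oscInt_translate (freqDeriv j a x) z h
    rw [show (fun ξ => a x (ξ + h)) - a x = G from rfl, hcG j,
      oscInt_add (hinth j) ((hint j).const_mul _), oscInt_const_mul] at h1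
    rw [hh] at h2
    linear_combination (-Complex.I / 2) * h1 + (1 / 2 * Complex.I ^ 2) * h2 +
      oscInt (freqDeriv j a x) z * Complex.I_sq
  have hK : oscKernel (a x) z = -(1 / 2) * oscInt G z := by
    rw [oscKernel_eq_sum hρ ha x hz]
    simp only [hosc]
    have := sum_radialWeight_mul hz
    calc _ = (∑ j, radialWeight j z * (-Complex.I * (z j : ℂ))) * (-(1 / 2) * oscInt G z) := by
          rw [Finset.sum_mul]
          exact Finset.sum_congr rfl fun j _ => by ring
      _ = _ := by rw [this, one_mul]
  rw [hK, norm_mul]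
  have h1 : ‖(-(1 / 2) : ℂ)‖ ≤ 1 := by norm_num
  exact (mul_le_of_le_one_left (norm_nonneg _) h1).trans (norm_oscInt_le G z)

theorem planeWave_half_period {z : 𝔼} (hz : z ≠ 0) :
    planeWave z ((π * (‖z‖ ^ 2)⁻¹) • z) = -1 := by
  have : ‖z‖ ≠ 0 := norm_ne_zero_iff.2 hz
  rw [planeWave, inner_smul_right, real_inner_self_eq_norm_sq,
    inv_mul_cancel_right₀ (pow_ne_zero 2 this), mul_comm, Complex.exp_pi_mul_I]

/-- The half period has length π/|z| ≥ 1. Increments over it cost (π/|z|)^N and have order m - Nρ <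
-n; their integral is then finite uniformly in the shift by translation invariance. -/
theorem norm_oscKernel_le_rpow_of_le_one {a : 𝔼 → 𝔼 → ℂ} (ha : IsHormanderSymbol m ρ δ a)
    (hρ : 0 < ρ) (hρ1 : ρ ≤ 1) {N : ℝ} (hN0 : 0 ≤ N) (hN1 : N ≤ 1) (hm : n + m < N * ρ) :
    ∃ C : ℝ, 0 ≤ C ∧ ∀ x z : 𝔼, z ≠ 0 → ‖z‖ ≤ 1 / 2 → ‖oscKernel (a x) z‖ ≤ C * ‖z‖ ^ (-N) := by
  obtain ⟨C, hC0, hC⟩ := ha.norm_translate_sub_le hρ1 hN0 hN1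
  have hw : m - N * ρ < -n := by linarith
  set J := ∫ ξ : 𝔼, (1 + ‖ξ‖) ^ (m - N * ρ) with hJ
  have hJ0 : 0 ≤ J := integral_nonneg fun ξ => by positivity
  refine ⟨((2 * π) ^ n)⁻¹ * (C * π ^ N * (J + J)), by positivity, fun x z hz hz1 => ?_⟩
  set h : 𝔼 := (π * (‖z‖ ^ 2)⁻¹) • z with hhdef
  have hz0 : 0 < ‖z‖ := norm_pos_iff.2 hz
  have hnorm : ‖h‖ = π * ‖z‖⁻¹ := by
    rw [hhdef, norm_smul, Real.norm_of_nonneg (by positivity)]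
    field_simp
  have hh1 : 1 ≤ ‖h‖ := by
    rw [hnorm, ← div_eq_mul_inv, le_div_iff₀ hz0]
    linarith [Real.pi_gt_three]
  have hi1 := integrable_one_add_norm_rpow (n := n) hw
  have hi2 : Integrable fun ξ : 𝔼 => (1 + ‖ξ + h‖) ^ (m - N * ρ) := hi1.comp_add_right h
  have hi := (hi1.add hi2).const_mul (C * ‖h‖ ^ N)
  have hcont := (ha.jointlySmooth.right x).continuous
  have hG : Integrable fun ξ => a x (ξ + h) - a x ξ :=
    hi.mono' ((hcont.comp (continuous_add_const h)).sub hcont).aestronglyMeasurable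
      (Filter.Eventually.of_forall fun ξ => hC x ξ h hh1)
  refine (norm_oscKernel_le_integral_translate hρ ha
    (by nlinarith) x hz (planeWave_half_period hz) hG).trans ?_
  rw [mul_assoc]
  refine mul_le_mul_of_nonneg_left ((integral_mono hG.norm hi fun ξ => hC x ξ h hh1).trans_eq ?_)
    (by positivity)
  simp only [Pi.add_apply]
  rw [integral_const_mul, integral_add hi1 hi2,
    integral_add_right_eq_self (fun ξ : 𝔼 => (1 + ‖ξ‖) ^ (m - N * ρ)) h, hnorm,
    Real.mul_rpow Real.pi_nonneg (by positivity), Real.inv_rpow hz0.le, Real.rpow_neg hz0.le]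
  ring

/-- The kernel of a symbol of order `m` is `O(|z|^{-N})` near `0` if `n + m < N ρ`, where `N` is
an integer or `ρ ≤ 1`. -/
theorem norm_oscKernel_le_rpow {a : 𝔼 → 𝔼 → ℂ} (ha : IsHormanderSymbol m ρ δ a) (hρ : 0 < ρ)
    {N : ℝ} (hN0 : 0 ≤ N) (hN : ρ ≤ 1 ∨ ∃ N₀ : ℕ, N = N₀) (hm : n + m < N * ρ) :
    ∃ C : ℝ, 0 ≤ C ∧ ∀ x z : 𝔼, z ≠ 0 → ‖z‖ ≤ 1 / 2 → ‖oscKernel (a x) z‖ ≤ C * ‖z‖ ^ (-N) := by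
  rcases hN with hρ1 | ⟨M, rfl⟩
  · obtain ⟨M, hM⟩ := exists_nat_ge N
    induction M generalizing m a N with
    | zero => exact norm_oscKernel_le_rpow_of_le_one ha hρ hρ1 hN0 (by simp at hM; linarith) hm
    | succ M ih =>
      rcases le_total N 1 with hN1 | hN1
      · exact norm_oscKernel_le_rpow_of_le_one ha hρ hρ1 hN0 hN1 hm
      -- One integration by parts lowers N by 1 and m by ρ, which preserves n + m < Nρ, until N lies
      -- in [0, 1].
      choose C hC0 hC using fun j => ih (ha.freqDeriv j) (N := N - 1) (by linarith) (by linarith)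
        (by push_cast at hM; linarith)
      refine ⟨∑ j, C j, Finset.sum_nonneg fun j _ => hC0 j, fun x z hz hz1 => ?_⟩
      rw [oscKernel_eq_sum hρ ha x hz, Finset.sum_mul]
      refine (norm_sum_le _ _).trans (Finset.sum_le_sum fun j _ => ?_)
      rw [norm_mul]
      calc ‖radialWeight j z‖ * ‖oscKernel (freqDeriv j a x) z‖
          ≤ ‖z‖⁻¹ * (C j * ‖z‖ ^ (-(N - 1))) :=
            mul_le_mul (norm_radialWeight_le j z) (hC j x z hz hz1) (norm_nonneg _) (by positivity)
        _ = C j * ‖z‖ ^ (-N) := by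
            have hz0 : 0 < ‖z‖ := norm_pos_iff.2 hz
            rw [← Real.rpow_neg_one, mul_left_comm, ← Real.rpow_add hz0]
            ring_nf
  · obtain ⟨C, hC0, hC⟩ := norm_oscKernel_le hρ (M := M) ha (by linarith)
    refine ⟨C, hC0, fun x z hz _ => (hC x z hz).trans_eq ?_⟩
    rw [Real.rpow_neg (norm_nonneg z), Real.rpow_natCast]

theorem norm_oscKernel_le_one_add {a : 𝔼 → 𝔼 → ℂ} (ha : IsHormanderSymbol m ρ δ a) (hρ : 0 < ρ)
    (N : ℝ) :
    ∃ C : ℝ, ∀ x z : 𝔼, 1 / 2 ≤ ‖z‖ → ‖oscKernel (a x) z‖ ≤ C * (1 + ‖z‖) ^ (-N) := by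
  obtain ⟨M₁, hM₁⟩ := exists_sub_mul_lt hρ m (-n)
  obtain ⟨M₂, hM₂⟩ := exists_nat_ge N
  set M := max M₁ M₂
  have h1 : (M₁ : ℝ) ≤ M := by exact_mod_cast le_max_left _ _
  have h2 : (M₂ : ℝ) ≤ M := by exact_mod_cast le_max_right _ _
  obtain ⟨C, hC0, hC⟩ := norm_oscKernel_le hρ (M := M) ha (by nlinarith)
  -- For |z| ≥ 1/2 one has 1 + |z| ≤ 3|z|.
  refine ⟨C * 3 ^ M, fun x z hz => ?_⟩
  have hz0 : 0 < ‖z‖ := by linarith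
  refine (hC x z (norm_pos_iff.1 hz0)).trans ?_
  rw [mul_assoc]
  refine mul_le_mul_of_nonneg_left ?_ hC0
  calc (‖z‖ ^ M)⁻¹ = 3 ^ M * ((3 * ‖z‖) ^ M)⁻¹ := by rw [mul_pow]; field_simp
    _ ≤ 3 ^ M * ((1 + ‖z‖) ^ M)⁻¹ := by gcongr; linarith
    _ = 3 ^ M * (1 + ‖z‖) ^ (-(M : ℝ)) := by rw [Real.rpow_neg (by positivity), Real.rpow_natCast]
    _ ≤ 3 ^ M * (1 + ‖z‖) ^ (-N) := by
        gcongr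
        · linarith
        · linarith

end KernelBounds

/-! ### The kernel represents the kernel-distribution. -/

section Pairing

variable {n : ℕ} {m ρ δ : ℝ}

local notation "𝔼" => EuclideanSpace ℝ (Fin n)

theorem HasCompactSupport.multiDeriv {f : 𝔼 → ℂ} (hf : HasCompactSupport f) (β : Fin n → ℕ) :
    HasCompactSupport (multiDeriv β f) :=
  (foldr_iterate_semiconj (P := HasCompactSupport) (T := id) (D := coordDeriv)
    (fun _ _ h => h.fderiv_apply (𝕜 := ℝ) _) (fun _ _ _ => rfl) β _ hf).1

theorem norm_multiDeriv_const_le (α : Fin n → ℕ) (c : ℂ) (x : 𝔼) :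
    ‖multiDeriv α (fun _ => c) x‖ ≤ ‖c‖ := by
  obtain ⟨c', hc', h⟩ := (foldr_iterate_semiconj
    (P := fun f : 𝔼 → ℂ => ∃ c' : ℂ, ‖c'‖ ≤ ‖c‖ ∧ f = fun _ => c') (T := id) (D := coordDeriv)
    (fun i f ⟨c', _, hf⟩ => ⟨0, by simp, by subst hf; funext x; simp [coordDeriv]⟩)
    (fun _ _ _ => rfl) α (List.finRange n) ⟨c, le_rfl, rfl⟩).1
  rw [multiDeriv, h]
  exact hc'

/-- A test function of the frequency is a symbol of every order. -/
theorem isHormanderSymbol_of_hasCompactSupport {ψ : 𝔼 → ℂ} (hψ : ContDiff ℝ ∞ ψ)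
    (hs : HasCompactSupport ψ) : IsHormanderSymbol m ρ δ (fun _ : 𝔼 => ψ) := by
  refine ⟨hψ.comp contDiff_snd, fun α β => ?_⟩
  set e := m - ρ * (multiLength β : ℝ) + δ * (multiLength α : ℝ)
  have hcont : Continuous fun ξ : 𝔼 => ((1 + ‖ξ‖) ^ (-e)) • multiDeriv β ψ ξ := by
    refine Continuous.smul (Continuous.rpow_const (by fun_prop) fun ξ => Or.inl ?_)
      (hψ.multiDeriv β).continuous
    positivity
  obtain ⟨C, hC⟩ := hcont.bounded_above_of_compact_support
    (HasCompactSupport.smul_left (f := fun ξ : 𝔼 => (1 + ‖ξ‖) ^ (-e)) (hs.multiDeriv β))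
  refine ⟨C, fun x ξ => (norm_multiDeriv_const_le α _ x).trans ?_⟩
  have h0 : (0 : ℝ) < 1 + ‖ξ‖ := by positivity
  have h := hC ξ
  rw [norm_smul, Real.norm_of_nonneg (by positivity), Real.rpow_neg h0.le,
    inv_mul_le_iff₀ (by positivity)] at h
  linarith

/-- A test function is an x-independent symbol of order -(n+1), so the decay of kernels at infinity
gives the rapid decay of its Fourier integral; near the origin plain boundedness suffices. -/
theorem norm_oscInt_le_one_add {ψ : 𝔼 → ℂ} (hψ : ContDiff ℝ ∞ ψ) (hs : HasCompactSupport ψ)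
    (N : ℝ) : ∃ C : ℝ, 0 ≤ C ∧ ∀ ξ, ‖oscInt ψ ξ‖ ≤ C * (1 + ‖ξ‖) ^ (-N) := by
  have hsym : IsHormanderSymbol (-(n + 1 : ℝ)) 1 0 (fun _ : 𝔼 => ψ) :=
    isHormanderSymbol_of_hasCompactSupport hψ hs
  have hm : (-(n + 1 : ℝ)) < -n := by linarith
  obtain ⟨C₁, h₁⟩ := norm_oscKernel_le_one_add hsym one_pos N
  obtain ⟨C₂, hC₂, h₂⟩ := hsym.norm_oscInt_le hm
  have h2 : (0 : ℝ) ≤ C₂ * 2 ^ |N| := by positivity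
  refine ⟨|C₁| + C₂ * 2 ^ |N|, by positivity, fun ξ => ?_⟩
  have h0 : (0 : ℝ) ≤ (1 + ‖ξ‖) ^ (-N) := by positivity
  rcases le_total (1 / 2) ‖ξ‖ with hξ | hξ
  · have := h₁ 0 ξ hξ
    rw [oscKernel_eq_oscInt one_pos hsym hm 0] at this
    refine this.trans (mul_le_mul_of_nonneg_right ?_ h0)
    linarith [le_abs_self C₁]
  · have h3 := rpow_le_of_comparable (u := 1 + ‖ξ‖) (v := 1) (by positivity) one_pos
      (by linarith) (by linarith [norm_nonneg ξ]) (-N)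
    rw [Real.one_rpow, abs_neg] at h3
    calc ‖oscInt ψ ξ‖ ≤ C₂ * 1 := by rw [mul_one]; exact h₂ 0 ξ
      _ ≤ C₂ * (2 ^ |N| * (1 + ‖ξ‖) ^ (-N)) := mul_le_mul_of_nonneg_left h3 hC₂
      _ ≤ _ := by
        rw [← mul_assoc]
        exact mul_le_mul_of_nonneg_right (by linarith [abs_nonneg C₁]) h0

theorem hasFDerivAt_oscInt_of_hasCompactSupport {ψ : 𝔼 → ℂ} (hψ : ContDiff ℝ ∞ ψ)
    (hs : HasCompactSupport ψ) (ξ : 𝔼) :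
    HasFDerivAt (oscInt ψ)
      (coordCLM fun j => Complex.I * oscInt (fun z => (z j : ℂ) * ψ z) ξ) ξ := by
  have hi : Integrable fun z => ‖z‖ * ‖ψ z‖ :=
    (continuous_norm.mul hψ.continuous.norm).integrable_of_hasCompactSupport hs.norm.mul_left
  simpa only [oscInt_const_mul] using
    hasFDerivAt_oscInt (hψ.continuous.integrable_of_hasCompactSupport hs) hi ξ

theorem kernelPairing_eq (a : 𝔼 → 𝔼 → ℂ) (x : 𝔼) (φ : 𝔼 → ℂ) :
    kernelPairing a x φ = ∫ ξ, a x ξ * oscInt φ ξ := by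
  rw [kernelPairing, ← integral_const_mul]
  congr 1
  funext ξ
  rw [oscInt, mul_left_comm]
  congr 3
  funext z
  rw [mul_comm, planeWave_comm, planeWave]

theorem contDiff_coord_mul {ψ : 𝔼 → ℂ} (hψ : ContDiff ℝ ∞ ψ) (j : Fin n) :
    ContDiff ℝ ∞ fun z : 𝔼 => (z j : ℂ) * ψ z :=
  (Complex.ofRealCLM ∘L (EuclideanSpace.proj j : 𝔼 →L[ℝ] ℝ)).contDiff.mul hψ

theorem IsHormanderSymbol.integrable_mul_oscInt {a : 𝔼 → 𝔼 → ℂ} (ha : IsHormanderSymbol m ρ δ a)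
    (x : 𝔼) {ψ : 𝔼 → ℂ} (hψ : ContDiff ℝ ∞ ψ) (hs : HasCompactSupport ψ) :
    Integrable fun ξ => a x ξ * oscInt ψ ξ := by
  obtain ⟨C, hC0, hC⟩ := ha.norm_le
  obtain ⟨C', hC'0, hC'⟩ := norm_oscInt_le_one_add hψ hs (m + n + 1)
  have hcont : Continuous (oscInt ψ) := continuous_iff_continuousAt.2 fun ξ =>
    (hasFDerivAt_oscInt_of_hasCompactSupport hψ hs ξ).continuousAt
  refine ((integrable_one_add_norm_rpow (m := -(n + 1 : ℝ)) (by linarith)).const_mul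
    (C * C')).mono' ((ha.jointlySmooth.right x).continuous.mul hcont).aestronglyMeasurable
    (Filter.Eventually.of_forall fun ξ => ?_)
  have h0 : (0 : ℝ) < 1 + ‖ξ‖ := by positivity
  rw [norm_mul]
  calc ‖a x ξ‖ * ‖oscInt ψ ξ‖
      ≤ (C * (1 + ‖ξ‖) ^ m) * (C' * (1 + ‖ξ‖) ^ (-(m + n + 1))) :=
        mul_le_mul (hC x ξ) (hC' ξ) (norm_nonneg _) (by positivity)
    _ = C * C' * ((1 + ‖ξ‖) ^ m * (1 + ‖ξ‖) ^ (-(m + n + 1))) := by ring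
    _ = C * C' * (1 + ‖ξ‖) ^ (-(n + 1 : ℝ)) := by
        rw [← Real.rpow_add h0]
        ring_nf

/-- The distributional counterpart of `coord_mul_oscKernel`: integration by parts in ξ, justified by
the rapid decay of the Fourier integral of the test function. -/
theorem kernelPairing_coord_mul {a : 𝔼 → 𝔼 → ℂ} (ha : IsHormanderSymbol m ρ δ a)
    (x : 𝔼) {ψ : 𝔼 → ℂ} (hψ : ContDiff ℝ ∞ ψ) (hs : HasCompactSupport ψ) (j : Fin n) :
    kernelPairing a x (fun z => (z j : ℂ) * ψ z) =
      Complex.I * kernelPairing (freqDeriv j a) x ψ := by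
  have hfd : ∀ ξ, fderiv ℝ (oscInt ψ) ξ (EuclideanSpace.single j 1) =
      Complex.I * oscInt (fun z => (z j : ℂ) * ψ z) ξ := fun ξ => by
    rw [(hasFDerivAt_oscInt_of_hasCompactSupport hψ hs ξ).fderiv, coordCLM_single]
  have h := integral_mul_fderiv_eq_neg_fderiv_mul_of_integrable (μ := volume) (f := a x)
    (g := oscInt ψ) (v := EuclideanSpace.single j 1)
    ((ha.freqDeriv j).integrable_mul_oscInt x hψ hs)
    (by
      simp only [hfd, mul_left_comm _ Complex.I]
      exact (ha.integrable_mul_oscInt x (contDiff_coord_mul hψ j) hs.mul_left).const_mul _)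
    (ha.integrable_mul_oscInt x hψ hs)
    (fun ξ _ => (ha.jointlySmooth.right x).differentiable (by simp) ξ)
    (fun ξ _ => (hasFDerivAt_oscInt_of_hasCompactSupport hψ hs ξ).differentiableAt)
  simp only [hfd, mul_left_comm _ Complex.I, integral_const_mul] at h
  rw [kernelPairing_eq, kernelPairing_eq]
  have h' : Complex.I * ∫ ξ, a x ξ * oscInt (fun z => (z j : ℂ) * ψ z) ξ =
    -∫ ξ, freqDeriv j a x ξ * oscInt ψ ξ := h
  linear_combination (-Complex.I) * h' + (∫ ξ, a x ξ * oscInt (fun z => (z j : ℂ) * ψ z) ξ) *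
    Complex.I_sq

theorem integral_oscInt_mul {g φ : 𝔼 → ℂ} (hg : Integrable g) (hφ : Integrable φ) :
    ∫ z, oscInt g z * φ z = ∫ ξ, g ξ * oscInt φ ξ := by
  have hi : Integrable (fun p : 𝔼 × 𝔼 => φ p.1 * g p.2 * planeWave p.1 p.2)
      (volume.prod volume) :=
    (hφ.mul_prod hg).mul_bdd (c := 1) continuous_planeWave.aestronglyMeasurable
      (Filter.Eventually.of_forall fun p => (norm_planeWave _ _).le)
  have h := integral_integral_swap (f := fun z ξ => φ z * g ξ * planeWave z ξ) hi
  have h1 : ∀ z, oscInt g z * φ z =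
      (((2 * π) ^ n)⁻¹ : ℝ) * ∫ ξ, φ z * g ξ * planeWave z ξ := fun z => by
    simp only [mul_assoc, integral_const_mul, oscInt]
    ring
  have h2 : ∀ ξ, g ξ * oscInt φ ξ =
      (((2 * π) ^ n)⁻¹ : ℝ) * ∫ z, φ z * g ξ * planeWave z ξ := fun ξ => by
    simp only [mul_comm (φ _) (g ξ), mul_assoc, integral_const_mul, oscInt,
      fun z => planeWave_comm z ξ]
    ring
  simp only [h1, h2, integral_const_mul, h]

/-- A test function supported away from the origin is `∑_j z_j ψ_j`, with `ψ_j` of the same kind. -/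
theorem exists_eq_sum_coord_mul {φ : 𝔼 → ℂ} (hφ : ContDiff ℝ ∞ φ) (hs : HasCompactSupport φ)
    (h0 : 0 ∉ tsupport φ) :
    ∃ ψ : Fin n → 𝔼 → ℂ, (∀ j, ContDiff ℝ ∞ (ψ j) ∧ HasCompactSupport (ψ j) ∧
      0 ∉ tsupport (ψ j)) ∧ ∀ z, φ z = ∑ j, (z j : ℂ) * ψ j z := by
  -- The weights are singular only at the origin, near which φ vanishes.
  refine ⟨fun j z => -Complex.I * radialWeight j z * φ z, fun j => ⟨?_, hs.mul_left, fun h => h0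
    (tsupport_mul_subset_right h)⟩, fun z => ?_⟩
  · refine contDiff_iff_contDiffAt.2 fun z => ?_
    by_cases hz : z = 0
    · subst hz
      have h : (fun z => -Complex.I * radialWeight j z * φ z) =ᶠ[nhds 0] fun _ => 0 := by
        filter_upwards [notMem_tsupport_iff_eventuallyEq.1 h0] with z hz
        rw [hz, Pi.zero_apply, mul_zero]
      exact contDiffAt_const.congr_of_eventuallyEq h
    · exact (contDiffAt_const.mul ((contDiffOn_radialWeight j).contDiffAt
        (isOpen_ne.mem_nhds hz))).mul hφ.contDiffAt
  · by_cases hz : z = 0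
    · subst hz
      simp [image_eq_zero_of_notMem_tsupport h0]
    · calc φ z = (∑ j, radialWeight j z * (-Complex.I * (z j : ℂ))) * φ z := by
            rw [sum_radialWeight_mul hz, one_mul]
        _ = _ := by
            rw [Finset.sum_mul]
            exact Finset.sum_congr rfl fun j _ => by ring

theorem integrable_oscKernel_mul {a : 𝔼 → 𝔼 → ℂ} (hρ : 0 < ρ) (ha : IsHormanderSymbol m ρ δ a)
    (x : 𝔼) {φ : 𝔼 → ℂ} (hφ : Continuous φ) (hs : HasCompactSupport φ) (h0 : 0 ∉ tsupport φ) :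
    Integrable fun z => oscKernel (a x) z * φ z := by
  refine Continuous.integrable_of_hasCompactSupport ?_ hs.mul_left
  refine continuous_iff_continuousAt.2 fun z => ?_
  by_cases hz : z = 0
  · subst hz
    have h : (fun z => oscKernel (a x) z * φ z) =ᶠ[nhds 0] fun _ => 0 := by
      filter_upwards [notMem_tsupport_iff_eventuallyEq.1 h0] with z hz
      rw [hz, Pi.zero_apply, mul_zero]
    exact continuousAt_const.congr h.symm
  · exact (hasFDerivAt_oscKernel_freq hρ x hz ha).continuousAt.mul hφ.continuousAt

/-- Writing φ = ∑ z_j ψ_j replaces the symbol by its ξ-derivatives on both sides, lowering the order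
by ρ; below order -n the claim is Fubini. -/
theorem integral_oscKernel_mul {a : 𝔼 → 𝔼 → ℂ} (hρ : 0 < ρ) (ha : IsHormanderSymbol m ρ δ a)
    (x : 𝔼) {φ : 𝔼 → ℂ} (hφ : ContDiff ℝ ∞ φ) (hs : HasCompactSupport φ) (h0 : 0 ∉ tsupport φ) :
    ∫ z, oscKernel (a x) z * φ z = kernelPairing a x φ := by
  obtain ⟨M, hM⟩ := exists_sub_mul_lt hρ m (-n)
  induction M generalizing m a φ with
  | zero =>
    rw [Nat.cast_zero, mul_zero, sub_zero] at hM
    rw [kernelPairing_eq, funext (oscKernel_eq_oscInt hρ ha hM x)]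
    exact integral_oscInt_mul (ha.integrable hM x)
      (hφ.continuous.integrable_of_hasCompactSupport hs)
  | succ M ih =>
    obtain ⟨ψ, hψ, hsum⟩ := exists_eq_sum_coord_mul hφ hs h0
    have h1 : ∀ z, oscKernel (a x) z * φ z =
        ∑ j, Complex.I * (oscKernel (freqDeriv j a x) z * ψ j z) := fun z => by
      rw [hsum, Finset.mul_sum]
      refine Finset.sum_congr rfl fun j _ => ?_
      by_cases hz : z = 0
      · subst hz
        simp [image_eq_zero_of_notMem_tsupport (hψ j).2.2]
      · rw [← mul_assoc Complex.I, ← coord_mul_oscKernel hρ ha x hz]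
        ring
    have h2 : ∀ j, ∫ z, oscKernel (freqDeriv j a x) z * ψ j z =
        kernelPairing (freqDeriv j a) x (ψ j) := fun j =>
      ih (ha.freqDeriv j) (hψ j).1 (hψ j).2.1 (hψ j).2.2 (by push_cast at hM; linarith)
    simp only [h1]
    rw [integral_finsetSum _ fun j _ => (integrable_oscKernel_mul hρ (ha.freqDeriv j) x
      (hψ j).1.continuous (hψ j).2.1 (hψ j).2.2).const_mul _]
    simp only [integral_const_mul, h2]
    have h3 : ∀ ξ, a x ξ * oscInt φ ξ =
        ∑ j, a x ξ * oscInt (fun z => (z j : ℂ) * ψ j z) ξ := fun ξ => by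
      rw [← Finset.mul_sum, funext hsum]
      congr 1
      simp only [oscInt, ← Finset.mul_sum, Finset.sum_mul]
      rw [integral_finsetSum _ fun j _ => Integrable.mul_planeWave
        ((contDiff_coord_mul (hψ j).1 j).continuous.integrable_of_hasCompactSupport
          (hψ j).2.1.mul_left) ξ]
    rw [kernelPairing_eq]
    simp only [h3]
    rw [integral_finsetSum _ fun j _ => ha.integrable_mul_oscInt x
      (contDiff_coord_mul (hψ j).1 j) (hψ j).2.1.mul_left]
    refine Finset.sum_congr rfl fun j _ => ?_
    rw [← kernelPairing_coord_mul ha x (hψ j).1 (hψ j).2.1 j, kernelPairing_eq]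

theorem continuous_oscInt_of_integrable {g : 𝔼 → ℂ} (hg : Integrable g) :
    Continuous (oscInt g) := by
  refine continuous_const.mul (continuous_of_dominated (bound := fun ξ => ‖g ξ‖)
    (fun z => (hg.mul_planeWave z).aestronglyMeasurable)
    (fun z => Filter.Eventually.of_forall fun ξ => ?_) hg.norm
    (Filter.Eventually.of_forall fun ξ => ?_))
  · rw [norm_mul, norm_planeWave, mul_one]
  · exact continuous_const.mul
      (continuous_planeWave.comp (by fun_prop : Continuous fun z : 𝔼 => (z, ξ)))

/-- Integrability at a single x says nothing about the order m, so the stabilisation of `regOsc` is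
no help. Off the origin both sides are continuous and have equal pairings with test functions, hence
coincide. -/
theorem oscKernel_eq_oscInt_of_integrable {a : 𝔼 → 𝔼 → ℂ} (hρ : 0 < ρ)
    (ha : IsHormanderSymbol m ρ δ a) {x : 𝔼} (hx : Integrable (a x)) (z : 𝔼) :
    oscKernel (a x) z = oscInt (a x) z := by
  by_cases hz : z = 0
  · rw [oscKernel, if_pos hz]
  set U : Set 𝔼 := {z | z ≠ 0} with hU
  have hUo : IsOpen U := isOpen_ne
  have hK : ContinuousOn (oscKernel (a x)) U := fun z hz =>
    (hasFDerivAt_oscKernel_freq hρ x hz ha).continuousAt.continuousWithinAt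
  have hI : ContinuousOn (oscInt (a x)) U := (continuous_oscInt_of_integrable hx).continuousOn
  have hae : ∀ᵐ z, z ∈ U → oscKernel (a x) z - oscInt (a x) z = 0 := by
    refine hUo.ae_eq_zero_of_integral_contDiff_smul_eq_zero
      ((hK.sub hI).locallyIntegrableOn hUo.measurableSet) fun g hg hgs hgU => ?_
    set φ : 𝔼 → ℂ := fun z => (g z : ℂ) with hφdef
    have hφ : ContDiff ℝ ∞ φ := Complex.ofRealCLM.contDiff.comp hg
    have hφs : HasCompactSupport φ := hgs.comp_left (g := fun t : ℝ => (t : ℂ)) (by simp)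
    have hφ0 : 0 ∉ tsupport φ := fun h =>
      hgU (closure_mono (Function.support_comp_subset (g := fun t : ℝ => (t : ℂ)) (by simp) g) h)
        rfl
    have hφi : Integrable φ := hφ.continuous.integrable_of_hasCompactSupport hφs
    have h1 := integral_oscKernel_mul hρ ha x hφ hφs hφ0
    have h2 := integral_oscInt_mul hx hφi
    rw [kernelPairing_eq, ← h2] at h1
    have h3 : Integrable fun z => oscInt (a x) z * φ z :=
      ((continuous_oscInt_of_integrable hx).mul hφ.continuous).integrable_of_hasCompactSupport
        hφs.mul_left
    calc ∫ z, g z • (oscKernel (a x) z - oscInt (a x) z)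
        = ∫ z, (oscKernel (a x) z * φ z - oscInt (a x) z * φ z) := by
          congr 1
          funext z
          rw [Complex.real_smul, hφdef]
          ring
      _ = 0 := by
          rw [integral_sub (integrable_oscKernel_mul hρ ha x hφ.continuous hφs hφ0) h3, h1,
            sub_self]
  have heq : oscKernel (a x) =ᵐ[volume.restrict U] oscInt (a x) :=
    (ae_restrict_iff' hUo.measurableSet).2 (hae.mono fun z h hz => sub_eq_zero.1 (h hz))
  exact Measure.eqOn_open_of_ae_eq heq hUo hK hI hz

theorem isSymbolKernel_oscKernel {σ : 𝔼 → 𝔼 → ℂ} (hρ : 0 < ρ) (hδ : 0 ≤ δ)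
    (hσ : IsHormanderSymbol m ρ δ σ) : IsSymbolKernel σ fun x => oscKernel (σ x) where
  smooth := contDiffOn_oscKernel hρ hδ hσ
  pairing x _ hφ hs h0 := integral_oscKernel_mul hρ hσ x hφ hs h0
  integral _ z hx := oscKernel_eq_oscInt_of_integrable hρ hσ hx z

end Pairing

/-! ### Besov norms from bounded derivatives. -/

section Besov

variable {n : ℕ} {m ρ δ : ℝ}

local notation "𝔼" => EuclideanSpace ℝ (Fin n)

/-- `f` is of class `C^k`, with all partial derivatives up to order `k` bounded by `A`. -/
def HasBoundedDerivs : ℕ → ℝ → (EuclideanSpace ℝ (Fin n) → ℂ) → Prop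
  | 0, A, f => Continuous f ∧ ∀ x, ‖f x‖ ≤ A
  | k + 1, A, f => Differentiable ℝ f ∧ (∀ x, ‖f x‖ ≤ A) ∧
      ∀ i, HasBoundedDerivs k A (coordDeriv i f)

namespace HasBoundedDerivs

variable {k : ℕ} {A B : ℝ} {f : EuclideanSpace ℝ (Fin n) → ℂ}

theorem continuous (hf : HasBoundedDerivs k A f) : Continuous f := by
  cases k with
  | zero => exact hf.1
  | succ k => exact hf.1.continuous

theorem norm_le (hf : HasBoundedDerivs k A f) (x : 𝔼) : ‖f x‖ ≤ A := by
  cases k with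
  | zero => exact hf.2 x
  | succ k => exact hf.2.1 x

theorem mono (hf : HasBoundedDerivs k A f) (hAB : A ≤ B) : HasBoundedDerivs k B f := by
  induction k generalizing f with
  | zero => exact ⟨hf.1, fun x => (hf.2 x).trans hAB⟩
  | succ k ih => exact ⟨hf.1, fun x => (hf.2.1 x).trans hAB, fun i => ih (hf.2.2 i)⟩

theorem isTemperedFunction (hf : HasBoundedDerivs k A f) : IsTemperedFunction f := by
  refine ⟨n + 1, ((integrable_one_add_norm_rpow (n := n) (m := -(n + 1 : ℝ))
    (by linarith)).mul_const A).mono' ?_ (Filter.Eventually.of_forall fun x => ?_)⟩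
  · have h : Continuous fun x : 𝔼 => ((1 + ‖x‖) ^ (n + 1))⁻¹ :=
      Continuous.inv₀ (by fun_prop) fun x => by positivity
    exact (h.smul hf.continuous).aestronglyMeasurable
  · rw [norm_smul, Real.norm_of_nonneg (by positivity), Real.rpow_neg (by positivity)]
    have : (1 + ‖x‖) ^ ((n : ℝ) + 1) = (1 + ‖x‖) ^ (n + 1) := by
      rw [← Real.rpow_natCast]
      push_cast
      rfl
    rw [this]
    exact mul_le_mul_of_nonneg_left (hf.norm_le x) (by positivity)

end HasBoundedDerivs

theorem fourierInv_eq_oscInt (g : 𝔼 → ℂ) (y : 𝔼) :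
    𝓕⁻ g y = (((2 * π) ^ n : ℝ) : ℂ) * oscInt g ((2 * π) • y) := by
  rw [Real.fourierInv_eq', oscInt, ← mul_assoc, ← Complex.ofReal_mul,
    mul_inv_cancel₀ (by positivity), Complex.ofReal_one, one_mul]
  congr 1
  funext ξ
  rw [planeWave, smul_eq_mul, mul_comm, inner_smul_left, real_inner_comm]
  congr 2
  simp
  ring

theorem integrable_fourierInv {g : 𝔼 → ℂ} (hg : ContDiff ℝ ∞ g) (hs : HasCompactSupport g) :
    Integrable (𝓕⁻ g) := by
  obtain ⟨C, -, hC⟩ := norm_oscInt_le_one_add hg hs (n + 1)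
  have h : Integrable (oscInt g) :=
    ((integrable_one_add_norm_rpow (n := n) (m := -(n + 1 : ℝ)) (by linarith)).const_mul C).mono'
      (continuous_oscInt_of_integrable
        (hg.continuous.integrable_of_hasCompactSupport hs)).aestronglyMeasurable
      (Filter.Eventually.of_forall hC)
  rw [funext (fourierInv_eq_oscInt g)]
  exact (h.comp_smul (by positivity : 2 * π ≠ 0)).const_mul _

theorem hasFDerivAt_fourierInv {g : 𝔼 → ℂ} (hg : ContDiff ℝ ∞ g) (hs : HasCompactSupport g)
    (y : 𝔼) :
    HasFDerivAt (𝓕⁻ g)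
      (coordCLM fun j => (2 * π) * Complex.I * 𝓕⁻ (fun ξ : 𝔼 => (ξ j : ℂ) * g ξ) y) y := by
  have h : HasFDerivAt (fun y : 𝔼 => (((2 * π) ^ n : ℝ) : ℂ) * oscInt g ((2 * π) • y)) _ y :=
    ((hasFDerivAt_oscInt_of_hasCompactSupport hg hs ((2 * π) • y)).comp y
      ((hasFDerivAt_id (𝕜 := ℝ) y).const_smul (2 * π))).const_mul _
  rw [funext (fourierInv_eq_oscInt g)]
  refine h.coordCLM fun j => ?_
  rw [fourierInv_eq_oscInt]
  simp [coordCLM_single]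
  ring

theorem oscInt_comp_smul (g : 𝔼 → ℂ) {t : ℝ} (ht : 0 < t) (z : 𝔼) :
    oscInt (fun ξ => g (t⁻¹ • ξ)) z = ((t ^ n : ℝ) : ℂ) * oscInt g (t • z) := by
  have h := Measure.integral_comp_smul (volume : Measure 𝔼)
    (fun ξ => g ξ * planeWave (t • z) ξ) t⁻¹
  rw [finrank_euclideanSpace_fin, abs_of_nonneg (by positivity), inv_pow, inv_inv,
    Complex.real_smul] at h
  rw [oscInt, oscInt, mul_left_comm, ← h]
  congr 2
  funext ξ
  rw [planeWave, planeWave, inner_smul_left, inner_smul_right]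
  simp [ht.ne']

/-- Dilation preserves the L¹ norm of the convolution kernel, which makes the block estimates
uniform over dyadic scales. -/
theorem integral_norm_fourierInv_comp_smul (g : 𝔼 → ℂ) {t : ℝ} (ht : 0 < t) :
    ∫ y, ‖𝓕⁻ (fun ξ : 𝔼 => g (t⁻¹ • ξ)) y‖ = ∫ y, ‖𝓕⁻ g y‖ := by
  have h := Measure.integral_comp_smul (volume : Measure 𝔼) (fun y => ‖𝓕⁻ g y‖) t
  rw [finrank_euclideanSpace_fin, abs_of_nonneg (by positivity), smul_eq_mul] at h
  have h1 : ∀ y, ‖𝓕⁻ (fun ξ : 𝔼 => g (t⁻¹ • ξ)) y‖ = t ^ n * ‖𝓕⁻ g (t • y)‖ := fun y => by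
    rw [fourierInv_eq_oscInt, fourierInv_eq_oscInt, oscInt_comp_smul g ht, mul_left_comm,
      norm_mul, Complex.norm_real, Real.norm_of_nonneg (by positivity), smul_comm]
  simp only [h1]
  rw [integral_const_mul, h, mul_inv_cancel_left₀ (by positivity)]

theorem norm_integral_mul_le {g f : 𝔼 → ℂ} (hg : Integrable g) {A : ℝ} (hf : ∀ x, ‖f x‖ ≤ A)
    (x : 𝔼) : ‖∫ y, g (x - y) * f y‖ ≤ (∫ y, ‖g y‖) * A := by
  have h1 : Integrable fun y => ‖g (x - y)‖ := (hg.comp_sub_left x).norm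
  rw [← integral_sub_left_eq_self (fun y => ‖g y‖) volume x, ← integral_mul_const]
  refine norm_integral_le_of_norm_le (h1.mul_const A) (Filter.Eventually.of_forall fun y => ?_)
  rw [norm_mul]
  exact mul_le_mul_of_nonneg_left (hf y) (norm_nonneg _)

/-- In a convolution with `𝓕⁻ (ξ_j ψ)`, a derivative can be moved to the other factor. -/
theorem integral_fourierInv_coord_mul {ψ f : 𝔼 → ℂ} (hψ : ContDiff ℝ ∞ ψ)
    (hs : HasCompactSupport ψ) (hf : Differentiable ℝ f) {A : ℝ} (hA : ∀ x, ‖f x‖ ≤ A)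
    (j : Fin n) (hfj : Continuous (coordDeriv j f)) (hAj : ∀ x, ‖coordDeriv j f x‖ ≤ A) (x : 𝔼) :
    (2 * π) * Complex.I * ∫ y, 𝓕⁻ (fun ξ : 𝔼 => (ξ j : ℂ) * ψ ξ) (x - y) * f y =
      ∫ y, 𝓕⁻ ψ (x - y) * coordDeriv j f y := by
  have hd : ∀ y, HasFDerivAt (fun y => 𝓕⁻ ψ (x - y)) _ y := fun y =>
    (hasFDerivAt_fourierInv hψ hs (x - y)).comp y ((hasFDerivAt_id (𝕜 := ℝ) y).const_sub x)
  have hfd : ∀ y, fderiv ℝ (fun y => 𝓕⁻ ψ (x - y)) y (EuclideanSpace.single j 1) =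
      -((2 * π) * Complex.I) * 𝓕⁻ (fun ξ : 𝔼 => (ξ j : ℂ) * ψ ξ) (x - y) := fun y => by
    rw [(hd y).fderiv]
    simp [coordCLM_single]
  have hfd' : ∀ y, fderiv ℝ (fun y => 𝓕⁻ ψ (x - y)) y (EuclideanSpace.single j 1) * f y =
      -((2 * π) * Complex.I) * (𝓕⁻ (fun ξ : 𝔼 => (ξ j : ℂ) * ψ ξ) (x - y) * f y) := fun y => by
    rw [hfd, mul_assoc]
  have hi1 : Integrable fun y => 𝓕⁻ ψ (x - y) := (integrable_fourierInv hψ hs).comp_sub_left x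
  have hi2 : Integrable fun y => 𝓕⁻ (fun ξ : 𝔼 => (ξ j : ℂ) * ψ ξ) (x - y) :=
    (integrable_fourierInv (contDiff_coord_mul hψ j) hs.mul_left).comp_sub_left x
  have hb : ∀ {g : 𝔼 → ℂ}, Integrable g → ∀ {f : 𝔼 → ℂ}, Continuous f → (∀ x, ‖f x‖ ≤ A) →
      Integrable fun y => g y * f y := fun hg f hf hA =>
    hg.mul_bdd (c := A) hf.aestronglyMeasurable (Filter.Eventually.of_forall hA)
  have h := integral_mul_fderiv_eq_neg_fderiv_mul_of_integrable (μ := volume)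
    (f := fun y => 𝓕⁻ ψ (x - y)) (g := f) (v := EuclideanSpace.single j 1)
    (by
      simp only [hfd']
      exact (hb hi2 hf.continuous hA).const_mul _)
    (hb hi1 hfj hAj) (hb hi1 hf.continuous hA)
    (fun y _ => (hd y).differentiableAt) (fun y _ => hf y)
  simp only [hfd', integral_const_mul] at h
  simp only [coordDeriv]
  rw [h, neg_mul, neg_neg]

/-- A frequency block of `f` at frequencies of size `t` is `O(t^{-k})` if `f` has `k` bounded
derivatives. -/
theorem norm_integral_fourierInv_le (k : ℕ) {g : 𝔼 → ℂ} (hg : ContDiff ℝ ∞ g)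
    (hs : HasCompactSupport g) (h0 : 0 ∉ tsupport g) :
    ∃ C : ℝ, 0 ≤ C ∧ ∀ (t A : ℝ) (f : 𝔼 → ℂ), 0 < t → HasBoundedDerivs k A f → ∀ x,
      ‖∫ y, 𝓕⁻ (fun ξ : 𝔼 => g (t⁻¹ • ξ)) (x - y) * f y‖ ≤ C * A * (t ^ k)⁻¹ := by
  have hsmooth : ∀ {ψ : 𝔼 → ℂ}, ContDiff ℝ ∞ ψ → ∀ t : ℝ,
      ContDiff ℝ ∞ fun ξ : 𝔼 => ψ (t⁻¹ • ξ) := fun h t => h.comp (contDiff_const_smul _)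
  have hsupp : ∀ {ψ : 𝔼 → ℂ}, HasCompactSupport ψ → ∀ t : ℝ, 0 < t →
      HasCompactSupport fun ξ : 𝔼 => ψ (t⁻¹ • ξ) := fun h t ht =>
    h.comp_homeomorph (Homeomorph.smulOfNeZero t⁻¹ (inv_ne_zero ht.ne'))
  induction k generalizing g with
  | zero =>
    refine ⟨∫ y, ‖𝓕⁻ g y‖, integral_nonneg fun y => norm_nonneg _, fun t A f ht hf x => ?_⟩
    rw [pow_zero, inv_one, mul_one, ← integral_norm_fourierInv_comp_smul g ht]
    exact norm_integral_mul_le (integrable_fourierInv (hsmooth hg t) (hsupp hs t ht)) hf.norm_le x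
  | succ k ih =>
    -- At scale t the multiplier is t^{-1} ∑ ξ_j ψ_j(ξ/t). The factor ξ_j becomes a derivative of f,
    -- up to 1/(2πi), so each bounded derivative gains t^{-1}.
    obtain ⟨ψ, hψ, hsum⟩ := exists_eq_sum_coord_mul hg hs h0
    choose C hC0 hC using fun j => ih (hψ j).1 (hψ j).2.1 (hψ j).2.2
    refine ⟨∑ j, C j, Finset.sum_nonneg fun j _ => hC0 j, fun t A f ht hf x => ?_⟩
    have hA0 : 0 ≤ A := (norm_nonneg _).trans (hf.norm_le 0)
    have hψs := fun j => hsmooth (hψ j).1 t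
    have hψc := fun j => hsupp (hψ j).2.1 t ht
    have h1 : ∀ y, 𝓕⁻ (fun ξ : 𝔼 => g (t⁻¹ • ξ)) y =
        ∑ j, (t⁻¹ : ℂ) * 𝓕⁻ (fun ξ : 𝔼 => (ξ j : ℂ) * ψ j (t⁻¹ • ξ)) y := fun y => by
      have e : ∀ ξ : 𝔼, g (t⁻¹ • ξ) * planeWave ((2 * π) • y) ξ = ∑ j, (t⁻¹ : ℂ) *
          ((ξ j : ℂ) * ψ j (t⁻¹ • ξ) * planeWave ((2 * π) • y) ξ) := fun ξ => by
        rw [hsum, Finset.sum_mul]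
        refine Finset.sum_congr rfl fun j _ => ?_
        rw [PiLp.smul_apply, smul_eq_mul]
        push_cast
        ring
      rw [fourierInv_eq_oscInt, oscInt]
      simp only [e]
      rw [integral_finsetSum _ fun j _ => (Integrable.mul_planeWave
        ((contDiff_coord_mul (hψs j) j).continuous.integrable_of_hasCompactSupport
          (hψc j).mul_left) _).const_mul _]
      simp only [integral_const_mul, Finset.mul_sum]
      refine Finset.sum_congr rfl fun j _ => ?_
      rw [fourierInv_eq_oscInt, oscInt]
      ring
    have hint : ∀ j, Integrable fun y =>
        (t⁻¹ : ℂ) * 𝓕⁻ (fun ξ : 𝔼 => (ξ j : ℂ) * ψ j (t⁻¹ • ξ)) (x - y) * f y := fun j =>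
      (((integrable_fourierInv (contDiff_coord_mul (hψs j) j)
        (hψc j).mul_left).comp_sub_left x).const_mul _).mul_bdd (c := A)
          hf.continuous.aestronglyMeasurable (Filter.Eventually.of_forall hf.norm_le)
    simp only [h1, Finset.sum_mul]
    rw [integral_finsetSum _ fun j _ => hint j]
    refine (norm_sum_le _ _).trans (Finset.sum_le_sum fun j _ => ?_)
    have h2 := integral_fourierInv_coord_mul (hψs j) (hψc j) hf.1 hf.2.1 j (hf.2.2 j).continuous
      (hf.2.2 j).norm_le x
    have h3 := hC j t A _ ht (hf.2.2 j) x
    rw [← h2, norm_mul] at h3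
    have h4 : 1 ≤ ‖(2 * π) * Complex.I‖ := by
      rw [norm_mul, Complex.norm_I, mul_one, norm_mul, Complex.norm_real,
        Real.norm_of_nonneg Real.pi_nonneg, Complex.norm_ofNat]
      linarith [Real.pi_gt_three]
    simp only [mul_assoc (t⁻¹ : ℂ)]
    rw [integral_const_mul, norm_mul, norm_inv, Complex.norm_real, Real.norm_of_nonneg ht.le]
    calc t⁻¹ * ‖∫ y, 𝓕⁻ (fun ξ : 𝔼 => (ξ j : ℂ) * ψ j (t⁻¹ • ξ)) (x - y) * f y‖
        ≤ t⁻¹ * (C j * A * (t ^ k)⁻¹) := by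
          refine mul_le_mul_of_nonneg_left (le_trans ?_ h3) (by positivity)
          exact le_mul_of_one_le_left (norm_nonneg _) h4
      _ = C j * A * (t ^ (k + 1))⁻¹ := by rw [pow_succ, mul_inv]; ring

/-- The profile of the dyadic cutoffs of positive index. -/
noncomputable def dyadicProfile (ξ : 𝔼) : ℂ :=
  ((lpBump n ((2 : ℝ)⁻¹ • ξ) - lpBump n ξ : ℝ) : ℂ)

theorem dyadicCutoff_succ (j : ℕ) (ξ : 𝔼) :
    (dyadicCutoff (j + 1) ξ : ℂ) = dyadicProfile (((2 : ℝ) ^ j)⁻¹ • ξ) := by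
  rw [dyadicProfile, dyadicCutoff, smul_smul, ← mul_inv, pow_succ']

theorem contDiff_dyadicProfile : ContDiff ℝ ∞ (dyadicProfile : 𝔼 → ℂ) :=
  Complex.ofRealCLM.contDiff.comp
    (((lpBump n).contDiff.comp (contDiff_const_smul _)).sub (lpBump n).contDiff)

theorem hasCompactSupport_dyadicProfile : HasCompactSupport (dyadicProfile : 𝔼 → ℂ) := by
  refine HasCompactSupport.comp_left (g := fun t : ℝ => (t : ℂ)) ?_ (by simp)
  exact ((lpBump n).hasCompactSupport.comp_homeomorph
    (Homeomorph.smulOfNeZero (2 : ℝ)⁻¹ (by norm_num))).sub (lpBump n).hasCompactSupport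

theorem zero_notMem_tsupport_dyadicProfile : 0 ∉ tsupport (dyadicProfile : 𝔼 → ℂ) := by
  refine notMem_tsupport_iff_eventuallyEq.2 ?_
  filter_upwards [Metric.closedBall_mem_nhds (0 : 𝔼) one_pos] with ξ hξ
  have hξ' : ‖ξ‖ ≤ 1 := by simpa using hξ
  have h2 : (2 : ℝ)⁻¹ • ξ ∈ Metric.closedBall (0 : 𝔼) 1 := by
    rw [mem_closedBall_zero_iff, norm_smul]
    norm_num
    linarith
  rw [dyadicProfile, (lpBump n).one_of_mem_closedBall hξ, (lpBump n).one_of_mem_closedBall h2]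
  simp

/-- Functions with `k` bounded derivatives belong to the Besov space `B^{k,∞}_∞`. -/
theorem besovNorm_le_of_hasBoundedDerivs (k : ℕ) :
    ∃ C : ℝ, 0 ≤ C ∧ ∀ (A : ℝ) (f : 𝔼 → ℂ), HasBoundedDerivs k A f →
      besovNorm (k : ℝ) f ≤ ENNReal.ofReal (C * A) := by
  obtain ⟨C, hC0, hC⟩ := norm_integral_fourierInv_le k (contDiff_dyadicProfile (n := n))
    hasCompactSupport_dyadicProfile zero_notMem_tsupport_dyadicProfile
  set g₀ : 𝔼 → ℂ := fun ξ => (dyadicCutoff 0 ξ : ℂ) with hg₀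
  have hint : Integrable (𝓕⁻ g₀) := by
    refine integrable_fourierInv (Complex.ofRealCLM.contDiff.comp (lpBump n).contDiff) ?_
    exact (lpBump n).hasCompactSupport.comp_left (g := fun t : ℝ => (t : ℂ)) (by simp)
  set C₀ := ∫ y, ‖𝓕⁻ g₀ y‖ with hC₀
  have hC₀0 : 0 ≤ C₀ := integral_nonneg fun y => norm_nonneg _
  have h2k : (0 : ℝ) ≤ 2 ^ k * C := by positivity
  -- The block of index 0 does not vanish at frequency 0 and only obeys the L¹–L^∞ bound, with
  -- constant C₀. Block j + 1 is the profile at scale 2^j, so the weight 2^{(j+1)k} against 2^{-jk}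
  -- leaves 2^k.
  refine ⟨C₀ + 2 ^ k * C, by positivity, fun A f hf => ?_⟩
  have hA0 : 0 ≤ A := (norm_nonneg _).trans (hf.norm_le 0)
  rw [besovNorm, if_pos hf.isTemperedFunction]
  refine iSup_le fun j => ?_
  have key : ∀ B : ℝ, (∀ x, ‖dyadicBlock j f x‖ ≤ B) →
      (2 : ℝ) ^ ((j : ℝ) * (k : ℝ)) * B ≤ (C₀ + 2 ^ k * C) * A →
      ENNReal.ofReal ((2 : ℝ) ^ ((j : ℝ) * (k : ℝ))) * eLpNorm (dyadicBlock j f) ⊤ volume ≤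
        ENNReal.ofReal ((C₀ + 2 ^ k * C) * A) := fun B hB hle => by
    refine (mul_le_mul_right ?_ _).trans ((ENNReal.ofReal_mul (by positivity)).symm.trans_le
      (ENNReal.ofReal_le_ofReal hle))
    rw [eLpNorm_exponent_top]
    exact eLpNormEssSup_le_of_ae_bound (Filter.Eventually.of_forall hB)
  cases j with
  | zero =>
    refine key (C₀ * A) (fun x => norm_integral_mul_le hint hf.norm_le x) ?_
    rw [Nat.cast_zero, zero_mul, Real.rpow_zero, one_mul]
    exact mul_le_mul_of_nonneg_right (by linarith) hA0
  | succ j =>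
    refine key (C * A * (((2 : ℝ) ^ j) ^ k)⁻¹) (fun x => ?_) ?_
    · simp only [dyadicBlock, dyadicCutoff_succ]
      exact hC _ A f (by positivity) hf x
    · have h1 : (2 : ℝ) ^ (((j + 1 : ℕ) : ℝ) * (k : ℝ)) = 2 ^ k * ((2 : ℝ) ^ j) ^ k := by
        rw [← Nat.cast_mul, Real.rpow_natCast, pow_mul, pow_succ', mul_pow]
      rw [h1]
      calc 2 ^ k * ((2 : ℝ) ^ j) ^ k * (C * A * (((2 : ℝ) ^ j) ^ k)⁻¹) = 2 ^ k * C * A := by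
            field_simp
        _ ≤ _ := mul_le_mul_of_nonneg_right (by linarith) hA0

/-- For N = 0 the hypothesis reads m < -n, so the integral is absolutely convergent and the bound
extends to z = 0. -/
theorem norm_oscKernel_le_rpow_or_zero (hρ : 0 < ρ) {a : 𝔼 → 𝔼 → ℂ} {N : ℝ}
    (hN0 : 0 ≤ N) (hN : ρ ≤ 1 ∨ ∃ N₀ : ℕ, N = N₀) (ha : IsHormanderSymbol m ρ δ a)
    (hm : n + m < N * ρ) :
    ∃ C : ℝ, 0 ≤ C ∧ ∀ x z : 𝔼, ‖z‖ ≤ 1 / 2 → z ≠ 0 ∨ N = 0 →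
      ‖oscKernel (a x) z‖ ≤ C * ‖z‖ ^ (-N) := by
  rcases eq_or_ne N 0 with rfl | hN'
  · have hm' : m < -n := by linarith
    obtain ⟨C, hC0, hC⟩ := ha.norm_oscInt_le hm'
    refine ⟨C, hC0, fun x z _ _ => ?_⟩
    rw [oscKernel_eq_oscInt hρ ha hm', neg_zero, Real.rpow_zero, mul_one]
    exact hC x z
  · obtain ⟨C, hC0, hC⟩ := norm_oscKernel_le_rpow ha hρ hN0 hN hm
    exact ⟨C, hC0, fun x z hz hzN => hC x z (hzN.resolve_right hN') hz⟩

/-- The kernel of a symbol has bounded derivatives in `x`, with the expected blow-up as `z → 0`. -/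
theorem hasBoundedDerivs_oscKernel (hρ : 0 < ρ) (hδ : 0 ≤ δ) {a : 𝔼 → 𝔼 → ℂ} {N : ℝ}
    (hN0 : 0 ≤ N) (hN : ρ ≤ 1 ∨ ∃ N₀ : ℕ, N = N₀) (k : ℕ) (ha : IsHormanderSymbol m ρ δ a)
    (hm : n + m + δ * k < N * ρ) :
    ∃ C : ℝ, 0 ≤ C ∧ ∀ z : 𝔼, ‖z‖ ≤ 1 / 2 → z ≠ 0 ∨ N = 0 →
      HasBoundedDerivs k (C * ‖z‖ ^ (-N)) fun x => oscKernel (a x) z := by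
  have hδk : 0 ≤ δ * k := by positivity
  obtain ⟨C₀, hC₀0, hC₀⟩ := norm_oscKernel_le_rpow_or_zero hρ hN0 hN ha (by linarith)
  induction k generalizing m a C₀ with
  | zero =>
    refine ⟨C₀, hC₀0, fun z hz hzN => ⟨?_, fun x => hC₀ x z hz hzN⟩⟩
    rcases hzN with h | rfl
    · exact continuous_iff_continuousAt.2 fun x =>
        (hasFDerivAt_oscKernel_space hρ hδ ha x (Or.inl h)).continuousAt
    · have hm' : m < -n := by linarith
      simp only [oscKernel_eq_oscInt hρ ha hm']
      exact (ha.continuous_oscInt hm').comp (by fun_prop : Continuous fun x : 𝔼 => (x, z))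
  | succ k ih =>
    push_cast at hm
    have hδk' : 0 ≤ δ * k := by positivity
    choose B hB0 hB using fun j => norm_oscKernel_le_rpow_or_zero hρ hN0 hN (ha.spaceDeriv j)
      (by linarith)
    choose C hC0 hC using fun j => ih (ha.spaceDeriv j) (by linarith) hδk' (B j) (hB0 j) (hB j)
    have hsum : 0 ≤ ∑ j, C j := Finset.sum_nonneg fun j _ => hC0 j
    refine ⟨C₀ + ∑ j, C j, by positivity, fun z hz hzN => ?_⟩
    have h0 : 0 ≤ ‖z‖ ^ (-N) := by positivity
    -- If N = 0, the hypothesis forces m + δ < -n, which permits differentiation under the integral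
    -- even at z = 0.
    have hd : ∀ x, HasFDerivAt (fun x' => oscKernel (a x') z)
        (coordCLM fun j => oscKernel (spaceDeriv j a x) z) x := fun x =>
      hasFDerivAt_oscKernel_space hρ hδ ha x
        (hzN.imp id fun h => by rw [h, zero_mul] at hm; linarith)
    refine ⟨fun x => (hd x).differentiableAt, fun x => (hC₀ x z hz hzN).trans
      (mul_le_mul_of_nonneg_right (by linarith) h0), fun j => ?_⟩
    have hj : coordDeriv j (fun x' => oscKernel (a x') z) =
        fun x => oscKernel (spaceDeriv j a x) z := funext fun x => by
      rw [coordDeriv, (hd x).fderiv, coordCLM_single]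
    rw [hj]
    refine (hC j z hz hzN).mono (mul_le_mul_of_nonneg_right ?_ h0)
    linarith [Finset.single_le_sum (f := C) (fun i _ => hC0 i) (Finset.mem_univ j)]

end Besov

/-! ### Assembly of the theorem. -/

theorem theorem2 (n : ℕ) (m ρ δ : ℝ) (hρ : 0 < ρ) (hδ : 0 ≤ δ)
    (σ : EuclideanSpace ℝ (Fin n) → EuclideanSpace ℝ (Fin n) → ℂ)
    (hσ : IsHormanderSymbol m ρ δ σ) :
    ∃ k : EuclideanSpace ℝ (Fin n) → EuclideanSpace ℝ (Fin n) → ℂ,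
      IsSymbolKernel σ k ∧
      (∀ (α β : Fin n → ℕ) (N : ℝ), 0 < N → ∃ C : ℝ,
        ∀ x z : EuclideanSpace ℝ (Fin n), 1 / 2 ≤ ‖z‖ →
          ‖mixedDeriv α β k x z‖ ≤ C * (1 + ‖z‖) ^ (-N)) ∧
      (∀ (α : ℕ) (β : Fin n → ℕ) (N : ℝ), 0 ≤ N → (ρ ≤ 1 ∨ ∃ N₀ : ℕ, N = (N₀ : ℝ)) →
        (n : ℝ) + m + δ * (α : ℝ) + max 1 ρ * (multiLength β : ℝ) < N * ρ →
        ∃ C : ℝ, ∀ z : EuclideanSpace ℝ (Fin n), ‖z‖ ≤ 1 / 2 → (z ≠ 0 ∨ N = 0) →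
          besovNorm (α : ℝ) (fun x => multiDeriv β (k x) z) ≤
            ENNReal.ofReal (C * ‖z‖ ^ (-N))) := by
  refine ⟨fun x => oscKernel (σ x), isSymbolKernel_oscKernel hρ hδ hσ, fun α β N _ => ?_,
    fun α β N hN0 hN hm => ?_⟩
  · obtain ⟨b, hb, hbσ⟩ := exists_symbol_multiDeriv_freq hρ hσ β
    obtain ⟨c, hc, hcb⟩ := exists_symbol_multiDeriv_space hρ hδ hb α
    obtain ⟨C, hC⟩ := norm_oscKernel_le_one_add hc hρ N
    refine ⟨C, fun x z hz => ?_⟩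
    have hz0 : z ≠ 0 := norm_pos_iff.1 (by linarith)
    rw [mixedDeriv, funext fun x' => hbσ x' z (Or.inl hz0), hcb x z hz0]
    exact hC x z hz
  · obtain ⟨b, hb, hbσ⟩ := exists_symbol_multiDeriv_freq hρ hσ β
    -- The symbol b has order m + max(1, ρ)|β|, so the hypothesis of (ii) is exactly what α further
    -- x-derivatives, each of cost δ, require.
    obtain ⟨C, -, hC⟩ := hasBoundedDerivs_oscKernel hρ hδ hN0 hN α hb (by linarith)
    obtain ⟨B, -, hB⟩ := besovNorm_le_of_hasBoundedDerivs (n := n) α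
    refine ⟨B * C, fun z hz hzN => ?_⟩
    have hδα : 0 ≤ δ * (α : ℝ) := by positivity
    -- When N = 0, discarding δα ≥ 0 shows that b has order below -n, so the formula for ∂_z^β also
    -- holds at z = 0.
    rw [funext fun x => hbσ x z (hzN.imp id fun h => by rw [h, zero_mul] at hm; linarith),
      mul_assoc]
    exact hB _ _ (hC z hz hzN)
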